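/- Let $p$ be a prime, let $B$ be a definite quaternion algebra over $\mathbb{Q}$ of discriminant $N^-$ coprime to $p$, let $N^+$ be a positive integer coprime to $pN^-$, and let $R\subset B$ be an Eichler $\mathbb{Z}$-order of level $N^+$. Fix an isomorphism $\iota\colon B\otimes_{\mathbb{Q}}\mathbb{Q}_p\to M_2(\mathbb{Q}_p)$ with $\iota(R\otimes\mathbb{Z}_p)=M_2(\mathbb{Z}_p)$, and let $\Gamma\subset \mathrm{SL}_2(\mathbb{Q}_p)$ be the image under $\iota$ of the group $R[1/p]^\times_1$ of units of $R[1/p]$ of reduced norm $1$. Let $k\ge 0$ be an even integer. Let $\Gamma_0(p\mathbb{Z}_p)$ be the group of matrices $\begin{pmatrix}a&b\\c&d\end{pmatrix}\in\mathrm{GL}_2(\mathbb{Z}_p)$ with $p\mid c$, and $\Sigma_0(p)$ the monoid of matrices $\begin{pmatrix}a&b\\c&d\end{pmatrix}\in M_2(\mathbb{Z}_p)$ with $p\mid c$, $a\in\mathbb{Z}_p^\times$ and $ad-bc\neq 0$. Let $\mathcal{P}_k\subset\mathbb{Q}_p[x]$ be the space of polynomials of degree at most $k$ and let $\mathbb{T}_k=\{\sum_n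 a_nx^n\in\mathbb{Q}_p[[x]] : a_n\to 0\}$ be the Tate algebra with the norm $\sup_n|a_n|_p$. Let $\mathrm{GL}_2(\mathbb{Q}_p)$ act on $\mathcal{P}_k$, and $\mathbb{Q}_p^\times\Sigma_0(p)$ on $\mathbb{T}_k$, from the left by \[(g\cdot_k f)(x)=\det(g)^{-k/2}(-cx+a)^k f\!\left(\frac{dx-b}{-cx+a}\right),\qquad g=\begin{pmatrix}a&b\\c&d\end{pmatrix}.\] Let $V_k=\mathrm{Hom}_{\mathbb{Q}_p}(\mathcal{P}_k,\mathbb{Q}_p)$ and $\mathbb{D}_k=\mathrm{Hom}_{\mathrm{cont}}(\mathbb{T}_k,\mathbb{Q}_p)$, with the dual right actions $(\omega\cdot_k g)(f)=\omega(g\cdot_k f)$, and let $\pi\colon\mathbb{D}_k\to V_k$ be restriction to $\mathcal{P}_k\subset\mathbb{T}_k$. For $V\in\{V_k,\mathbb{D}_k\}$ let $\mathbb{A}(\Gamma,V)$ be the space of maps $\phi\colon\mathrm{GL}_2(\mathbb{Q}_p)\to V$ with $\phi(u\gamma g)=\phi(g)$ and $\phi(g\sigma)=\phi(g)\cdot_k\sigma$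 for all $u\in\mathbb{Q}_p^\times$, $\gamma\in\Gamma$, $\sigma\in\Gamma_0(p\mathbb{Z}_p)$ and $g\in\mathrm{GL}_2(\mathbb{Q}_p)$. Put $\mathbb{A}_k(\Gamma)=\mathbb{A}(\Gamma,V_k)$ ($p$-adic automorphic forms) and $\mathcal{A}_k(\Gamma)=\mathbb{A}(\Gamma,\mathbb{D}_k)$ (rigid analytic automorphic forms), let $\rho\colon\mathcal{A}_k(\Gamma)\to\mathbb{A}_k(\Gamma)$, $\Phi\mapsto\pi\circ\Phi$, be the specialization map, and on both spaces let \[(U_p\phi)(g)=p^{k/2}\sum_{j=0}^{p-1}\phi(g\alpha_j)\cdot_k\alpha_j^{-1},\qquad \alpha_j=\begin{pmatrix}p&j\\0&1\end{pmatrix}.\] Then $\rho$ restricts to an isomorphism of $\mathbb{Q}_p$-vector spaces \[\rho\colon\mathcal{A}_k(\Gamma)^{U_p=p^{k/2}}\longrightarrow\mathbb{A}_k(\Gamma)^{U_p=p^{k/2}}\] between the subspaces on which $U_p$ acts as multiplication by $p^{k/2}$. -/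

import Mathlib

open scoped Quaternion TensorProduct PowerSeries Polynomial Topology

noncomputable section

namespace PadicAut

/-! ### Definite quaternion algebras over the rationals, orders and the group `Γ`

The quaternion algebra `ℍ[ℚ,a,b]` is generated by `i`, `j` with `i² = a`, `j² = b`, `ij = -ji`;
its canonical involution is `star`, and the reduced norm of `x` is `x * star x`. It is definite
exactly when `a < 0` and `b < 0`. -/

/-- `N` is the discriminant of the quaternion algebra `ℍ[ℚ,a,b]`, i.e. the product of the primes
at which the algebra does not split. -/
def IsDiscriminant (a b : ℚ) (N : ℕ) : Prop :=
  Squarefree N ∧ ∀ (l : ℕ) [Fact l.Prime],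
    l ∣ N ↔ IsEmpty ((ℚ_[l] ⊗[ℚ] ℍ[ℚ,a,b]) ≃ₐ[ℚ_[l]] Matrix (Fin 2) (Fin 2) ℚ_[l])

/-- A `ℤ`-order in `ℍ[ℚ,a,b]`: a subring that is a full `ℤ`-lattice. -/
def IsZOrder {a b : ℚ} (O : Subring ℍ[ℚ,a,b]) : Prop :=
  O.toAddSubgroup.FG ∧ Submodule.span ℚ (O : Set ℍ[ℚ,a,b]) = ⊤

/-- `R` is an Eichler `ℤ`-order of level `N`: the intersection of two (not necessarily distinct)
maximal orders, of index `N` in them. -/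
def IsEichlerOrder {a b : ℚ} (R : Subring ℍ[ℚ,a,b]) (N : ℕ) : Prop :=
  ∃ O₁ O₂ : Subring ℍ[ℚ,a,b], Maximal IsZOrder O₁ ∧ Maximal IsZOrder O₂ ∧ R = O₁ ⊓ O₂ ∧
    R.toAddSubgroup.relIndex O₁.toAddSubgroup = N ∧
    R.toAddSubgroup.relIndex O₂.toAddSubgroup = N

/-- The ring `R[1/p]`, as a subring of the quaternion algebra. -/
def awayFrom {a b : ℚ} (R : Subring ℍ[ℚ,a,b]) (p : ℕ) : Subring ℍ[ℚ,a,b] where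
  carrier := {x | ∃ n : ℕ, (p : ℍ[ℚ,a,b]) ^ n * x ∈ R}
  one_mem' := ⟨0, by simp⟩
  zero_mem' := ⟨0, by simp⟩
  mul_mem' := by
    rintro x y ⟨m, hm⟩ ⟨n, hn⟩
    refine ⟨m + n, ?_⟩
    have h : (p : ℍ[ℚ,a,b]) ^ (m + n) * (x * y) = (p ^ m * x) * (p ^ n * y) := by
      have hc : (p : ℍ[ℚ,a,b]) ^ n * x = x * (p : ℍ[ℚ,a,b]) ^ n :=
        ((Nat.cast_commute p x).pow_left n).eq
      rw [pow_add, mul_assoc, ← mul_assoc _ x y, hc]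
      simp only [mul_assoc]
    rw [h]
    exact R.mul_mem hm hn
  add_mem' := by
    rintro x y ⟨m, hm⟩ ⟨n, hn⟩
    refine ⟨m + n, ?_⟩
    have hp : ∀ i : ℕ, (p : ℍ[ℚ,a,b]) ^ i ∈ R := fun i => R.pow_mem (natCast_mem R p) i
    have h : (p : ℍ[ℚ,a,b]) ^ (m + n) * (x + y) = p ^ n * (p ^ m * x) + p ^ m * (p ^ n * y) := by
      rw [mul_add, ← mul_assoc, ← mul_assoc, ← pow_add, ← pow_add, add_comm n m]
    rw [h]
    exact R.add_mem (R.mul_mem (hp n) hm) (R.mul_mem (hp m) hn)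
  neg_mem' := by
    rintro x ⟨m, hm⟩
    exact ⟨m, by simpa using R.neg_mem hm⟩

/-- The group of units of `R[1/p]` of reduced norm `1`. -/
def normOneUnits {a b : ℚ} (R : Subring ℍ[ℚ,a,b]) (p : ℕ) : Subgroup (ℍ[ℚ,a,b])ˣ where
  carrier := {u | (u : ℍ[ℚ,a,b]) ∈ awayFrom R p ∧ ((u⁻¹ : (ℍ[ℚ,a,b])ˣ) : ℍ[ℚ,a,b]) ∈ awayFrom R p ∧
    (u : ℍ[ℚ,a,b]) * star (u : ℍ[ℚ,a,b]) = 1}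
  one_mem' := by simp
  mul_mem' := by
    rintro u v ⟨hu, hu', hun⟩ ⟨hv, hv', hvn⟩
    refine ⟨?_, ?_, ?_⟩
    · simpa using Subring.mul_mem _ hu hv
    · simpa using Subring.mul_mem _ hv' hu'
    · rw [Units.val_mul, star_mul, mul_assoc, ← mul_assoc (v : ℍ[ℚ,a,b]), hvn, one_mul, hun]
  inv_mem' := by
    rintro u ⟨hu, hu', hun⟩
    refine ⟨hu', by simpa using hu, ?_⟩
    have h : ((u⁻¹ : (ℍ[ℚ,a,b])ˣ) : ℍ[ℚ,a,b]) = star (u : ℍ[ℚ,a,b]) := by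
      rw [← mul_one ((u⁻¹ : (ℍ[ℚ,a,b])ˣ) : ℍ[ℚ,a,b]), ← hun, Units.inv_mul_cancel_left]
    rw [h, star_star, ← h, Units.inv_mul]

section padic

variable (p : ℕ) [Fact p.Prime]

/-- A `p`-adic splitting `B_p = ℚ_p ⊗ B ≃ M₂(ℚ_p)` takes `R_p = R ⊗ ℤ_p` onto `M₂(ℤ_p)`. -/
def IsIntegralSplitting {a b : ℚ} (R : Subring ℍ[ℚ,a,b])
    (ι : (ℚ_[p] ⊗[ℚ] ℍ[ℚ,a,b]) ≃ₐ[ℚ_[p]] Matrix (Fin 2) (Fin 2) ℚ_[p]) : Prop :=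
  ι '' (Submodule.span ℤ_[p] {x | ∃ r ∈ R, x = (1 : ℚ_[p]) ⊗ₜ[ℚ] r} :
      Submodule ℤ_[p] (ℚ_[p] ⊗[ℚ] ℍ[ℚ,a,b])) =
    {M : Matrix (Fin 2) (Fin 2) ℚ_[p] | ∀ i j, ‖M i j‖ ≤ 1}

/-- The group `Γ = R[1/p]^×_1`, regarded as a group of matrices through the splitting `ι`. -/
def gammaGroup {a b : ℚ} (R : Subring ℍ[ℚ,a,b])
    (ι : (ℚ_[p] ⊗[ℚ] ℍ[ℚ,a,b]) ≃ₐ[ℚ_[p]] Matrix (Fin 2) (Fin 2) ℚ_[p]) :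
    Subgroup (GL (Fin 2) ℚ_[p]) :=
  (normOneUnits R p).map (Units.map (ι.toRingEquiv.toRingHom.comp
    (Algebra.TensorProduct.includeRight :
      ℍ[ℚ,a,b] →ₐ[ℚ] ℚ_[p] ⊗[ℚ] ℍ[ℚ,a,b]).toRingHom).toMonoidHom)

/-! ### The group `Γ₀(pℤ_p)` and the monoid `Σ₀(p)` -/

/-- The Iwahori subgroup `Γ₀(pℤ_p)` of `GL₂(ℤ_p)`, inside `GL₂(ℚ_p)`. -/
def gamma0 : Set (GL (Fin 2) ℚ_[p]) :=
  {g | ∃ σ : GL (Fin 2) ℤ_[p], (p : ℤ_[p]) ∣ (σ : Matrix (Fin 2) (Fin 2) ℤ_[p]) 1 0 ∧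
    g = Matrix.GeneralLinearGroup.map (PadicInt.Coe.ringHom (p := p)) σ}

/-- `Σ₀(p)`: matrices over `ℤ_p` with nonzero determinant, lower left entry divisible by `p` and
upper left entry a unit. -/
def sigma0 : Set (Matrix (Fin 2) (Fin 2) ℤ_[p]) :=
  {M | (p : ℤ_[p]) ∣ M 1 0 ∧ IsUnit (M 0 0) ∧ M.det ≠ 0}

/-- `ℚ_p^× Σ₀(p)`, inside `GL₂(ℚ_p)`. -/
def qpSigma0 : Set (GL (Fin 2) ℚ_[p]) :=
  {g | ∃ u : ℚ_[p]ˣ, ∃ M ∈ sigma0 p, (g : Matrix (Fin 2) (Fin 2) ℚ_[p]) =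
    (u : ℚ_[p]) • M.map (PadicInt.Coe.ringHom (p := p))}

lemma gamma0_subset : gamma0 p ⊆ qpSigma0 p := by
  rintro g ⟨σ, hσ, rfl⟩
  refine ⟨1, σ, ⟨hσ, ?_, ?_⟩, ?_⟩
  · have hd : IsUnit ((σ : Matrix (Fin 2) (Fin 2) ℤ_[p]).det) :=
      (Matrix.isUnit_iff_isUnit_det _).1 σ.isUnit
    by_contra h
    obtain ⟨c, hc⟩ := hσ
    have h1 : (σ : Matrix (Fin 2) (Fin 2) ℤ_[p]) 0 0 ∈ IsLocalRing.maximalIdeal ℤ_[p] := h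
    have h2 : (p : ℤ_[p]) ∈ IsLocalRing.maximalIdeal ℤ_[p] := by
      rw [PadicInt.maximalIdeal_eq_span_p]
      exact Ideal.mem_span_singleton_self _
    have h3 : (σ : Matrix (Fin 2) (Fin 2) ℤ_[p]).det ∈ IsLocalRing.maximalIdeal ℤ_[p] := by
      rw [Matrix.det_fin_two, hc]
      refine Ideal.sub_mem _ (Ideal.mul_mem_right _ _ h1) (Ideal.mul_mem_left _ _ ?_)
      exact Ideal.mul_mem_right _ _ h2
    exact h3 hd
  · exact ((Matrix.isUnit_iff_isUnit_det _).1 σ.isUnit).ne_zero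
  · ext i j
    rw [Units.val_one, one_smul]
    rfl

/-- The matrix `α_j = (p j; 0 1)`. -/
def alpha (j : ℕ) : GL (Fin 2) ℚ_[p] :=
  Matrix.GeneralLinearGroup.mkOfDetNeZero !![(p : ℚ_[p]), (j : ℚ_[p]); 0, 1]
    (by simpa [Matrix.det_fin_two] using (Fact.out : p.Prime).ne_zero)

lemma alpha_inv_mem (j : ℕ) : (alpha p j)⁻¹ ∈ qpSigma0 p := by
  have hp : (p : ℚ_[p]) ≠ 0 := by simpa using (Fact.out : p.Prime).ne_zero
  have hp' : (p : ℤ_[p]) ≠ 0 := by simpa using (Fact.out : p.Prime).ne_zero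
  refine ⟨(Units.mk0 (p : ℚ_[p]) hp)⁻¹, !![1, -(j : ℤ_[p]); 0, (p : ℤ_[p])], ⟨?_, ?_, ?_⟩, ?_⟩
  · simp
  · simp
  · simpa [Matrix.det_fin_two] using hp'
  · rw [Matrix.coe_units_inv, alpha]
    refine Matrix.inv_eq_right_inv ?_
    have h : (!![1, -(j : ℤ_[p]); 0, (p : ℤ_[p])]).map (PadicInt.Coe.ringHom (p := p)) =
        !![1, -(j : ℚ_[p]); 0, (p : ℚ_[p])] := by
      ext i j
      fin_cases i <;> fin_cases j <;> simp
    rw [h]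
    ext i j
    fin_cases i <;> fin_cases j <;>
      simp [Matrix.GeneralLinearGroup.mkOfDetNeZero, Matrix.mul_apply, hp]

/-! ### Polynomials of degree at most `k`, and `V_k` -/

/-- `𝒫_k`: polynomials over `ℚ_p` of degree at most `k`. -/
abbrev PolyLE (k : ℕ) : Type := ↥(Polynomial.degreeLE ℚ_[p] (k : WithBot ℕ))

/-- The right action `(P ∣ g)(x) = det(g)^(-k/2) (cx+d)^k P((ax+b)/(cx+d))` on `𝒫_k`, for
`g = (a b; c d)`. -/
def polySlash (k : ℕ) (g : GL (Fin 2) ℚ_[p]) : PolyLE p k →ₗ[ℚ_[p]] PolyLE p k where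
  toFun P := ⟨((g : Matrix (Fin 2) (Fin 2) ℚ_[p]).det⁻¹ ^ (k / 2)) •
      ∑ i ∈ Finset.range (k + 1), (P : ℚ_[p][X]).coeff i •
        ((Polynomial.C (g 0 0) * Polynomial.X + Polynomial.C (g 0 1)) ^ i *
          (Polynomial.C (g 1 0) * Polynomial.X + Polynomial.C (g 1 1)) ^ (k - i)), by
    refine Submodule.smul_mem _ _ (Submodule.sum_mem _ fun i hi => Submodule.smul_mem _ _ ?_)
    rw [Polynomial.mem_degreeLE]
    have hi' : i + (k - i) = k := by
      have := Finset.mem_range.1 hi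
      omega
    have h1 : ∀ u v : ℚ_[p], ∀ n : ℕ,
        ((Polynomial.C u * Polynomial.X + Polynomial.C v) ^ n).natDegree ≤ n := fun u v n =>
      (Polynomial.natDegree_pow_le_of_le n (Polynomial.natDegree_linear_le)).trans (by simp)
    refine Polynomial.degree_le_of_natDegree_le ?_
    refine Polynomial.natDegree_mul_le.trans ?_
    exact (add_le_add (h1 _ _ _) (h1 _ _ _)).trans hi'.le⟩
  map_add' P Q := by
    ext1
    simp [add_smul, Finset.sum_add_distrib]
  map_smul' r P := by
    ext1
    simp only [Submodule.coe_smul, Polynomial.coeff_smul, smul_eq_mul, mul_smul, RingHom.id_apply]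
    rw [← Finset.smul_sum, smul_comm]

/-- `V_k`, the linear dual of `𝒫_k`. -/
abbrev Vk (k : ℕ) : Type := Module.Dual ℚ_[p] (PolyLE p k)

/-- The right action of `GL₂(ℚ_p)` on `V_k`: it is dual to the left action `g · P = P ∣ g⁻¹`. -/
def vkAct (k : ℕ) (g : GL (Fin 2) ℚ_[p]) : Vk p k →ₗ[ℚ_[p]] Vk p k :=
  (polySlash p k g⁻¹).dualMap

/-! ### The Tate algebra and the rigid analytic distributions `𝔻_k` -/

/-- The Tate algebra in one variable: power series whose coefficients tend to `0`. -/
def tateSubalgebra : Subalgebra ℚ_[p] ℚ_[p]⟦X⟧ where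
  carrier := {f | Filter.Tendsto (fun n => PowerSeries.coeff n f) Filter.atTop (𝓝 0)}
  mul_mem' := by
    intro f g hf hg
    have hiff : ∀ h : ℚ_[p]⟦X⟧, h.IsRestricted 1 ↔
        Filter.Tendsto (fun n => PowerSeries.coeff n h) Filter.atTop (𝓝 0) := fun h => by
      rw [PowerSeries.isRestricted_iff']
      simp only [one_pow, mul_one]
      exact tendsto_zero_iff_norm_tendsto_zero.symm
    exact (hiff _).1 (PowerSeries.isRestricted.mul 1 ((hiff _).2 hf) ((hiff _).2 hg))
  add_mem' := by
    intro f g hf hg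
    simpa using Filter.Tendsto.add hf hg
  algebraMap_mem' := by
    intro r
    refine tendsto_const_nhds.congr' ?_
    filter_upwards [Filter.eventually_gt_atTop 0] with n hn
    simp [PowerSeries.coeff_C, hn.ne']

/-- The Tate algebra as a type. -/
abbrev Tate : Type := ↥(tateSubalgebra p)

/-- The coefficient sequence of an element of the Tate algebra, in the Banach space of null
sequences with the sup-norm. -/
def tateCoeffs : Tate p →ₗ[ℚ_[p]] ZeroAtInftyContinuousMap ℕ ℚ_[p] where
  toFun f := ⟨⟨fun n => PowerSeries.coeff n (f : ℚ_[p]⟦X⟧), continuous_of_discreteTopology⟩, by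
    rw [Filter.cocompact_eq_cofinite, Nat.cofinite_eq_atTop]
    exact f.2⟩
  map_add' f g := by
    ext n
    simp
  map_smul' r f := by
    ext n
    simp

lemma tateCoeffs_apply (f : Tate p) (n : ℕ) :
    tateCoeffs p f n = PowerSeries.coeff n (f : ℚ_[p]⟦X⟧) := rfl

lemma tateCoeffs_injective : Function.Injective (tateCoeffs p) := by
  intro f g h
  ext n
  simpa [tateCoeffs_apply] using DFunLike.congr_fun h n

/-- The norm on the Tate algebra: `‖∑ a_n x^n‖ = sup_n ‖a_n‖`. -/
instance : NormedAddCommGroup (Tate p) :=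
  NormedAddCommGroup.induced (Tate p) (ZeroAtInftyContinuousMap ℕ ℚ_[p]) (tateCoeffs p)
    (tateCoeffs_injective p)

instance : NormedSpace ℚ_[p] (Tate p) :=
  NormedSpace.induced ℚ_[p] (Tate p) (ZeroAtInftyContinuousMap ℕ ℚ_[p]) (tateCoeffs p)

lemma tate_norm_eq (f : Tate p) : ‖f‖ = ‖tateCoeffs p f‖ := rfl

lemma norm_coeff_le (f : Tate p) (n : ℕ) : ‖PowerSeries.coeff n (f : ℚ_[p]⟦X⟧)‖ ≤ ‖f‖ := by
  rw [tate_norm_eq, ← ZeroAtInftyContinuousMap.norm_toBCF_eq_norm]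
  exact (tateCoeffs p f).toBCF.norm_coe_le_norm n

lemma tate_norm_le (f : Tate p) {C : ℝ} (hC : 0 ≤ C)
    (h : ∀ n, ‖PowerSeries.coeff n (f : ℚ_[p]⟦X⟧)‖ ≤ C) : ‖f‖ ≤ C := by
  rw [tate_norm_eq, ← ZeroAtInftyContinuousMap.norm_toBCF_eq_norm]
  exact (BoundedContinuousFunction.norm_le hC).2 h

/-- The power series `(-cx+a)^k ((dx-b)/(-cx+a))^n`, for `M = (a b; c d)`. -/
def tateMonomial (k : ℕ) (M : Matrix (Fin 2) (Fin 2) ℚ_[p]) (n : ℕ) : ℚ_[p]⟦X⟧ :=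
  (PowerSeries.C (M 0 0) - PowerSeries.C (M 1 0) * PowerSeries.X) ^ k *
    ((PowerSeries.C (M 1 1) * PowerSeries.X - PowerSeries.C (M 0 1)) *
      (PowerSeries.C (M 0 0) - PowerSeries.C (M 1 0) * PowerSeries.X)⁻¹) ^ n

/-- Elements of the Tate algebra of norm at most `1`. -/
def tateUnitBall : Submonoid ℚ_[p]⟦X⟧ where
  carrier := {f | f ∈ tateSubalgebra p ∧ ∀ n, ‖PowerSeries.coeff n f‖ ≤ 1}
  one_mem' := ⟨(tateSubalgebra p).one_mem, fun n => by
    rw [PowerSeries.coeff_one]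
    split_ifs <;> simp⟩
  mul_mem' := by
    rintro f g ⟨hf, hf'⟩ ⟨hg, hg'⟩
    refine ⟨(tateSubalgebra p).mul_mem hf hg, fun n => ?_⟩
    rw [PowerSeries.coeff_mul]
    refine IsUltrametricDist.norm_sum_le_of_forall_le_of_nonneg zero_le_one fun x _ => ?_
    rw [norm_mul]
    exact mul_le_one₀ (hf' _) (norm_nonneg _) (hg' _)

lemma linear_mem_tateUnitBall {u v : ℚ_[p]} (hu : ‖u‖ ≤ 1) (hv : ‖v‖ ≤ 1) :
    PowerSeries.C u * PowerSeries.X + PowerSeries.C v ∈ tateUnitBall p := by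
  have hc : ∀ n, PowerSeries.coeff n (PowerSeries.C u * PowerSeries.X + PowerSeries.C v) =
      (if n = 1 then u else 0) + (if n = 0 then v else 0) := fun n => by
    simp [PowerSeries.coeff_X, PowerSeries.coeff_C]
  refine ⟨?_, fun n => ?_⟩
  · refine tendsto_const_nhds.congr' ?_
    filter_upwards [Filter.eventually_gt_atTop 1] with n hn
    rw [hc, if_neg (by omega), if_neg (by omega), add_zero]
  · rw [hc]
    rcases n with _ | _ | n <;> simp [hu, hv]

lemma inv_mem_tateUnitBall {a c : ℚ_[p]} (ha : ‖a‖ = 1) (hc : ‖c‖ < 1) :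
    (PowerSeries.C a - PowerSeries.C c * PowerSeries.X)⁻¹ ∈ tateUnitBall p := by
  have ha0 : a ≠ 0 := by
    rintro rfl
    simp at ha
  have h : (PowerSeries.C a - PowerSeries.C c * PowerSeries.X)⁻¹ =
      PowerSeries.mk fun n => a⁻¹ * (c * a⁻¹) ^ n := by
    symm
    rw [PowerSeries.eq_inv_iff_mul_eq_one (by simpa using ha0)]
    ext n
    rw [mul_sub, ← mul_assoc, map_sub]
    rcases n with _ | n
    · simp [ha0]
    · rw [PowerSeries.coeff_succ_mul_X, PowerSeries.coeff_mul_C, PowerSeries.coeff_mul_C,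
        PowerSeries.coeff_mk, PowerSeries.coeff_mk, PowerSeries.coeff_one, if_neg (by omega)]
      rw [pow_succ]
      linear_combination (-c * (c * a⁻¹) ^ n * a⁻¹) * (mul_inv_cancel₀ ha0) +
        2 * c * a⁻¹ * (c * a⁻¹) ^ n * (mul_inv_cancel₀ ha0)
  have hn : ‖c * a⁻¹‖ < 1 := by simpa [ha] using hc
  rw [h]
  refine ⟨?_, fun n => ?_⟩
  · change Filter.Tendsto (fun n => PowerSeries.coeff n (PowerSeries.mk _)) _ _
    simp only [PowerSeries.coeff_mk]
    simpa using (tendsto_pow_atTop_nhds_zero_of_norm_lt_one hn).const_mul a⁻¹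
  · rw [PowerSeries.coeff_mk, norm_mul, norm_pow, norm_inv, ha]
    simpa using pow_le_one₀ (norm_nonneg _) hn.le

lemma tateMonomial_bound (k : ℕ) {g : GL (Fin 2) ℚ_[p]} (hg : g ∈ qpSigma0 p) :
    ∃ C : ℝ, 0 ≤ C ∧ ∀ n, tateMonomial p k g n ∈ tateSubalgebra p ∧
      ∀ m, ‖PowerSeries.coeff m (tateMonomial p k g n)‖ ≤ C := by
  obtain ⟨u, M, ⟨hc, ha, -⟩, hM⟩ := hg
  have hu : (u : ℚ_[p]) ≠ 0 := u.ne_zero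
  set A : Matrix (Fin 2) (Fin 2) ℚ_[p] := M.map (PadicInt.Coe.ringHom (p := p)) with hA
  have hA1 : ∀ i j, ‖A i j‖ ≤ 1 := fun i j => (M i j).2
  have ha' : ‖A 0 0‖ = 1 := PadicInt.isUnit_iff.1 ha
  have hc' : ‖A 1 0‖ < 1 := (PadicInt.norm_lt_one_iff_dvd _).2 hc
  have hmem : ∀ n, tateMonomial p k A n ∈ tateUnitBall p := fun n => by
    refine mul_mem (pow_mem ?_ _) (pow_mem (mul_mem ?_ ?_) _)
    · have := linear_mem_tateUnitBall p (u := -A 1 0) (v := A 0 0) (by simpa using hA1 1 0)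
        (hA1 0 0)
      simpa [sub_eq_add_neg, add_comm] using this
    · have := linear_mem_tateUnitBall p (u := A 1 1) (v := -A 0 1) (hA1 1 1)
        (by simpa using hA1 0 1)
      simpa [sub_eq_add_neg] using this
    · exact inv_mem_tateUnitBall p ha' hc'
  have hscale : ∀ n, tateMonomial p k g n = ((u : ℚ_[p]) ^ k) • tateMonomial p k A n := fun n => by
    have e1 : PowerSeries.C (((u : ℚ_[p]) • A) 0 0) -
        PowerSeries.C (((u : ℚ_[p]) • A) 1 0) * PowerSeries.X = PowerSeries.C (u : ℚ_[p]) *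
        (PowerSeries.C (A 0 0) - PowerSeries.C (A 1 0) * PowerSeries.X) := by
      simp only [Matrix.smul_apply, smul_eq_mul, map_mul]
      ring
    have e2 : PowerSeries.C (((u : ℚ_[p]) • A) 1 1) * PowerSeries.X -
        PowerSeries.C (((u : ℚ_[p]) • A) 0 1) = PowerSeries.C (u : ℚ_[p]) *
        (PowerSeries.C (A 1 1) * PowerSeries.X - PowerSeries.C (A 0 1)) := by
      simp only [Matrix.smul_apply, smul_eq_mul, map_mul]
      ring
    have e3 : PowerSeries.C (u : ℚ_[p]) * (PowerSeries.C (u : ℚ_[p]))⁻¹ = 1 :=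
      PowerSeries.mul_inv_cancel _ (by simp)
    rw [hM, tateMonomial, e1, e2, PowerSeries.mul_inv_rev, PowerSeries.smul_eq_C_mul, map_pow,
      tateMonomial, mul_pow, mul_assoc]
    congr 2
    congr 1
    linear_combination ((PowerSeries.C (A 1 1) * PowerSeries.X - PowerSeries.C (A 0 1)) *
      (PowerSeries.C (A 0 0) - PowerSeries.C (A 1 0) * PowerSeries.X)⁻¹) * e3
  refine ⟨‖(u : ℚ_[p]) ^ k‖, norm_nonneg _, fun n => ⟨?_, fun m => ?_⟩⟩
  · rw [hscale]
    exact (tateSubalgebra p).smul_mem (hmem n).1 _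
  · rw [hscale, PowerSeries.coeff_smul, smul_eq_mul, norm_mul]
    exact mul_le_of_le_one_right (norm_nonneg _) ((hmem n).2 m)

lemma tate_summable (k : ℕ) {g : GL (Fin 2) ℚ_[p]} (hg : g ∈ qpSigma0 p) (f : Tate p) (m : ℕ) :
    Summable fun n => PowerSeries.coeff n (f : ℚ_[p]⟦X⟧) *
      PowerSeries.coeff m (tateMonomial p k g n) := by
  obtain ⟨C, -, hC⟩ := tateMonomial_bound p k hg
  refine NonarchimedeanAddGroup.summable_of_tendsto_cofinite_zero ?_
  rw [Nat.cofinite_eq_atTop]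
  refine Filter.Tendsto.zero_mul_isBoundedUnder_le f.2 ?_
  exact Filter.isBoundedUnder_of ⟨C, fun n => (hC n).2 m⟩

/-- The substitution `f ↦ (-cx+a)^k f((dx-b)/(-cx+a))` for `g = (a b; c d)` in `ℚ_p^× Σ₀(p)`, as a
power series: if `f = ∑ a_n x^n`, this is `∑ a_n (-cx+a)^k ((dx-b)/(-cx+a))^n`, and each
coefficient is a convergent series. -/
def tateSubst (k : ℕ) (g : GL (Fin 2) ℚ_[p]) (f : Tate p) : ℚ_[p]⟦X⟧ :=
  PowerSeries.mk fun m => ∑' n, PowerSeries.coeff n (f : ℚ_[p]⟦X⟧) *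
    PowerSeries.coeff m (tateMonomial p k g n)

lemma tateSubst_mem (k : ℕ) {g : GL (Fin 2) ℚ_[p]} (hg : g ∈ qpSigma0 p) (f : Tate p) :
    tateSubst p k g f ∈ tateSubalgebra p := by
  obtain ⟨C, hC0, hC⟩ := tateMonomial_bound p k hg
  change Filter.Tendsto (fun m => PowerSeries.coeff m (PowerSeries.mk _)) _ _
  simp only [PowerSeries.coeff_mk]
  rw [Metric.tendsto_atTop]
  intro ε hε
  have hf := Metric.tendsto_atTop.1 f.2 (ε / 2 / (C + 1)) (by positivity)
  obtain ⟨N, hN⟩ := hf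
  have hfin : ∀ᶠ m in Filter.atTop, ∀ n ∈ Finset.range N,
      ‖PowerSeries.coeff n (f : ℚ_[p]⟦X⟧) * PowerSeries.coeff m (tateMonomial p k g n)‖ < ε / 2 := by
    rw [Filter.eventually_all_finset]
    intro n _
    have h0 : Filter.Tendsto (fun m => PowerSeries.coeff n (f : ℚ_[p]⟦X⟧) *
        PowerSeries.coeff m (tateMonomial p k g n)) Filter.atTop (𝓝 0) := by
      simpa using (show Filter.Tendsto (fun m => PowerSeries.coeff m (tateMonomial p k g n))
        Filter.atTop (𝓝 0) from (hC n).1).const_mul (PowerSeries.coeff n (f : ℚ_[p]⟦X⟧))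
    have h1 := (tendsto_zero_iff_norm_tendsto_zero.1 h0).eventually (gt_mem_nhds (half_pos hε))
    exact h1
  obtain ⟨m₀, hm₀⟩ := Filter.eventually_atTop.1 hfin
  refine ⟨m₀, fun m hm => ?_⟩
  rw [dist_zero_right]
  refine lt_of_le_of_lt ?_ (half_lt_self hε)
  refine IsUltrametricDist.norm_tsum_le_of_forall_le_of_nonneg (half_pos hε).le fun n => ?_
  by_cases hn : n < N
  · exact (hm₀ m hm n (Finset.mem_range.2 hn)).le
  · have h1 := (hN n (not_lt.1 hn)).le
    rw [dist_zero_right] at h1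
    rw [norm_mul]
    calc _ ≤ ε / 2 / (C + 1) * (C + 1) :=
          mul_le_mul h1 (((hC n).2 m).trans (by linarith)) (norm_nonneg _) (by positivity)
      _ = ε / 2 := by field_simp

/-- The left action of `g = (a b; c d)` in `ℚ_p^× Σ₀(p)` on the Tate algebra in weight `k`:
`(g · f)(x) = det(g)^(-k/2) (-cx+a)^k f((dx-b)/(-cx+a))`. For even `k` the formula is unchanged
when `g` is multiplied by a scalar, so that `g = uσ` acts as `σ`. -/
def tateAct (k : ℕ) (g : qpSigma0 p) : Tate p →L[ℚ_[p]] Tate p :=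
  LinearMap.mkContinuousOfExistsBound
    { toFun := fun f => ((g : GL (Fin 2) ℚ_[p]) : Matrix (Fin 2) (Fin 2) ℚ_[p]).det⁻¹ ^ (k / 2) •
        (⟨tateSubst p k g f, tateSubst_mem p k g.2 f⟩ : Tate p)
      map_add' := fun f f' => by
        rw [← smul_add]
        congr 1
        ext m
        simp only [tateSubst, PowerSeries.coeff_mk, Subalgebra.coe_add, map_add, add_mul]
        exact Summable.tsum_add (tate_summable p k g.2 f m) (tate_summable p k g.2 f' m)
      map_smul' := fun r f => by
        rw [RingHom.id_apply, smul_comm]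
        congr 1
        ext m
        simp only [tateSubst, PowerSeries.coeff_mk, Subalgebra.coe_smul, PowerSeries.coeff_smul,
          smul_eq_mul, mul_assoc]
        exact tsum_mul_left }
    (by
      obtain ⟨C, hC0, hC⟩ := tateMonomial_bound p k g.2
      refine ⟨‖((g : GL (Fin 2) ℚ_[p]) : Matrix (Fin 2) (Fin 2) ℚ_[p]).det⁻¹ ^ (k / 2)‖ * C,
        fun f => ?_⟩
      refine (norm_smul_le _ _).trans ?_
      rw [mul_assoc]
      refine mul_le_mul_of_nonneg_left ?_ (norm_nonneg _)
      refine tate_norm_le p _ (by positivity) fun m => ?_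
      simp only [tateSubst, PowerSeries.coeff_mk]
      refine IsUltrametricDist.norm_tsum_le_of_forall_le_of_nonneg (by positivity) fun n => ?_
      rw [norm_mul, mul_comm C]
      exact mul_le_mul (norm_coeff_le p f n) ((hC n).2 m) (norm_nonneg _) (norm_nonneg _))

/-- Rigid analytic distributions `𝔻_k`: the continuous dual of the Tate algebra (the weight only
enters through the action). -/
abbrev Dk : Type := Tate p →L[ℚ_[p]] ℚ_[p]

/-- The right action of `ℚ_p^× Σ₀(p)` on `𝔻_k`, dual to the weight-`k` action on the Tate
algebra. -/
def dkAct (k : ℕ) (g : qpSigma0 p) : Dk p →ₗ[ℚ_[p]] Dk p where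
  toFun ω := ω.comp (tateAct p k g)
  map_add' _ _ := rfl
  map_smul' _ _ := rfl

/-- The inclusion of `𝒫_k` into the Tate algebra. -/
def polyToTate (k : ℕ) : PolyLE p k →ₗ[ℚ_[p]] Tate p where
  toFun P := ⟨((P : ℚ_[p][X]) : ℚ_[p]⟦X⟧), by
    refine tendsto_const_nhds.congr' ?_
    filter_upwards [Filter.eventually_gt_atTop (P : ℚ_[p][X]).natDegree] with n hn
    simp [Polynomial.coeff_eq_zero_of_natDegree_lt hn]⟩
  map_add' P Q := by
    ext n
    simp
  map_smul' r P := by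
    ext n
    simp

/-- The map `π : 𝔻_k → V_k` dual to the inclusion of `𝒫_k` into the Tate algebra. -/
def piMap (k : ℕ) : Dk p →ₗ[ℚ_[p]] Vk p k where
  toFun ω := (ω : Tate p →ₗ[ℚ_[p]] ℚ_[p]).comp (polyToTate p k)
  map_add' _ _ := rfl
  map_smul' _ _ := rfl

/-! ### Automorphic forms -/

/-- `V`-valued `p`-adic automorphic forms on `GL₂(ℚ_p)` invariant under `Γ`: the functions that are
left `ℚ_p^× Γ`-invariant and right `Γ₀(pℤ_p)`-equivariant. Here `act` is the right action of
`ℚ_p^× Σ₀(p)` on `V`. -/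
def AutForm (Γ : Subgroup (GL (Fin 2) ℚ_[p])) {V : Type} [AddCommGroup V] [Module ℚ_[p] V]
    (act : qpSigma0 p → V →ₗ[ℚ_[p]] V) : Submodule ℚ_[p] (GL (Fin 2) ℚ_[p] → V) where
  carrier := {φ |
    (∀ (u : ℚ_[p]ˣ), ∀ γ ∈ Γ, ∀ g,
      φ (Matrix.GeneralLinearGroup.scalar (Fin 2) u * γ * g) = φ g) ∧
    ∀ (g : GL (Fin 2) ℚ_[p]) (σ : GL (Fin 2) ℚ_[p]) (hσ : σ ∈ gamma0 p),
      φ (g * σ) = act ⟨σ, gamma0_subset p hσ⟩ (φ g)}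
  zero_mem' := by simp
  add_mem' := by
    rintro φ ψ ⟨h1, h2⟩ ⟨h3, h4⟩
    refine ⟨fun u γ hγ g => ?_, fun g σ hσ => ?_⟩
    · simp [h1 u γ hγ g, h3 u γ hγ g]
    · simp [h2 g σ hσ, h4 g σ hσ]
  smul_mem' := by
    rintro r φ ⟨h1, h2⟩
    refine ⟨fun u γ hγ g => ?_, fun g σ hσ => ?_⟩
    · simp [h1 u γ hγ g]
    · simp [h2 g σ hσ]

/-- The operator `(U_p φ)(g) = p^(k/2) ∑_{j < p} φ(g α_j) · α_j⁻¹`, on functions on `GL₂(ℚ_p)`. -/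
def Up (k : ℕ) {V : Type} [AddCommGroup V] [Module ℚ_[p] V]
    (act : qpSigma0 p → V →ₗ[ℚ_[p]] V) :
    (GL (Fin 2) ℚ_[p] → V) →ₗ[ℚ_[p]] (GL (Fin 2) ℚ_[p] → V) where
  toFun φ g := (p : ℚ_[p]) ^ (k / 2) • ∑ j ∈ Finset.range p,
    act ⟨(alpha p j)⁻¹, alpha_inv_mem p j⟩ (φ (g * alpha p j))
  map_add' φ ψ := by
    ext g
    simp [Finset.sum_add_distrib]
  map_smul' r φ := by
    ext g
    simp only [Pi.smul_apply, map_smul, RingHom.id_apply]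
    rw [← Finset.smul_sum, smul_comm]

/-- The space `𝒜_k(Γ)` of rigid analytic automorphic forms of weight `k`. -/
def rigidForms (k : ℕ) (Γ : Subgroup (GL (Fin 2) ℚ_[p])) :
    Submodule ℚ_[p] (GL (Fin 2) ℚ_[p] → Dk p) :=
  AutForm p Γ (dkAct p k)

/-- The space `𝔸_k(Γ)` of `p`-adic automorphic forms of weight `k`. -/
def padicForms (k : ℕ) (Γ : Subgroup (GL (Fin 2) ℚ_[p])) :
    Submodule ℚ_[p] (GL (Fin 2) ℚ_[p] → Vk p k) :=
  AutForm p Γ fun g => vkAct p k g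

/-- The subspace of `𝒜_k(Γ)` on which `U_p = p^(k/2)`. -/
def rigidEigen (k : ℕ) (Γ : Subgroup (GL (Fin 2) ℚ_[p])) :
    Submodule ℚ_[p] (GL (Fin 2) ℚ_[p] → Dk p) :=
  rigidForms p k Γ ⊓ Module.End.eigenspace (Up p k (dkAct p k)) ((p : ℚ_[p]) ^ (k / 2))

/-- The subspace of `𝔸_k(Γ)` on which `U_p = p^(k/2)`. -/
def padicEigen (k : ℕ) (Γ : Subgroup (GL (Fin 2) ℚ_[p])) :
    Submodule ℚ_[p] (GL (Fin 2) ℚ_[p] → Vk p k) :=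
  padicForms p k Γ ⊓ Module.End.eigenspace (Up p k fun g => vkAct p k g) ((p : ℚ_[p]) ^ (k / 2))

/-- The specialization map `ρ`, which composes with `π : 𝔻_k → V_k`. -/
def specialization (k : ℕ) :
    (GL (Fin 2) ℚ_[p] → Dk p) →ₗ[ℚ_[p]] (GL (Fin 2) ℚ_[p] → Vk p k) :=
  (piMap p k).compLeft (GL (Fin 2) ℚ_[p])

end padic

end PadicAut

end

open PadicAut

/-! The theorem is a control theorem of Stevens type. The matrix `(alpha p j)⁻¹` acts on the Tate
algebra by `f(x) ↦ p^(-k/2) f(px + j)`, so the coefficient of `x^m` gains the factor `p^(m - k/2)`,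
which is divisible by `p` once `m > k`. A distribution killed by `piMap` sees only those
coefficients. Hence `UpNorm`, that is `p^(-k/2) U_p`, shrinks norms by `‖p‖` on the functions with
values in the kernel of `piMap` (`norm_sum_dkAct_alpha_inv_le`). Both halves of the theorem follow
from this contraction once automorphic forms are known to be bounded.

Injectivity: an eigenform with zero specialization is bounded and fixed by a contraction, hence zero
(`eq_zero_of_specialization_eq_zero`). Surjectivity: lift an eigenform value by value through
truncation of power series and iterate `UpNorm`. Successive iterates have the same specialization,
so they converge geometrically (`exists_limit_of_iterates`). The truncation lift is not equivariant
under the Iwahori group, but the defect of equivariance of the limit is again bounded, killed by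
`piMap` and reproduced by a contraction, so it vanishes (`equivariant_of_bounded`).

Boundedness rests on the finiteness of `Γ \ GL₂(ℚ_p) / ℚ_p^× Γ₀(pℤ_p)`
(`finiteDoubleCosets_gammaGroup`), proved by a pigeonhole argument. A primitive integral `G` with
determinant of valuation `v` is a left divisor of some nonzero `x ∈ R` with coordinates of size at
most about `p^(v/2)`. As the norm form is positive definite, the reduced norm of `x` is `p^v` times
a number bounded independently of `G`. So `x = G m` where `m` has bounded determinant, and finitely
many congruence data attached to `x` and `m` determine the double coset (`same_double_coset`). -/

noncomputable section

namespace PadicAut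

/-! ### Tate algebra: monomial expansions and evaluation at points of `ℤ_p`. -/

section tate

variable (p : ℕ) [Fact p.Prime]

/-- The variable of the Tate algebra. -/
def tateX : Tate p := ⟨PowerSeries.X, by
  simpa using (linear_mem_tateUnitBall p (u := 1) (v := 0) (by simp) (by simp)).1⟩

lemma coeff_smul_tateX_pow (r : ℚ_[p]) (n m : ℕ) :
    PowerSeries.coeff m ((r • tateX p ^ n : Tate p) : ℚ_[p]⟦X⟧) = if m = n then r else 0 := by
  have : ((r • tateX p ^ n : Tate p) : ℚ_[p]⟦X⟧) = r • PowerSeries.X ^ n := rfl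
  rw [this, PowerSeries.coeff_smul, PowerSeries.coeff_X_pow]
  simp

lemma coe_tate_sum {ι : Type*} (s : Finset ι) (f : ι → Tate p) :
    ((∑ i ∈ s, f i : Tate p) : ℚ_[p]⟦X⟧) = ∑ i ∈ s, (f i : ℚ_[p]⟦X⟧) :=
  map_sum (tateSubalgebra p).val _ _

lemma tate_hasSum (f : Tate p) :
    HasSum (fun n => PowerSeries.coeff n (f : ℚ_[p]⟦X⟧) • tateX p ^ n) f := by
  rw [HasSum, SummationFilter.unconditional_filter, Metric.tendsto_atTop]
  intro ε hε
  obtain ⟨N, hN⟩ := Metric.tendsto_atTop.1 f.2 (ε / 2) (half_pos hε)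
  refine ⟨Finset.range N, fun s hs => lt_of_le_of_lt ?_ (half_lt_self hε)⟩
  rw [dist_eq_norm]
  refine tate_norm_le p _ (half_pos hε).le fun m => ?_
  have h : PowerSeries.coeff m ((∑ n ∈ s, PowerSeries.coeff n (f : ℚ_[p]⟦X⟧) • tateX p ^ n - f :
      Tate p) : ℚ_[p]⟦X⟧) = if m ∈ s then 0 else - PowerSeries.coeff m (f : ℚ_[p]⟦X⟧) := by
    rw [Subalgebra.coe_sub, map_sub, coe_tate_sum, map_sum]
    simp only [coeff_smul_tateX_pow, Finset.sum_ite_eq]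
    split_ifs <;> simp
  rw [h]
  split_ifs with hm
  · simpa using (half_pos hε).le
  · have := hN m (by
      by_contra hlt
      exact hm (hs (Finset.mem_range.2 (not_le.1 hlt))))
    rw [dist_zero_right] at this
    simpa using this.le

lemma map_tate_hasSum {E : Type*} [NormedAddCommGroup E] [NormedSpace ℚ_[p] E]
    (L : Tate p →L[ℚ_[p]] E) (f : Tate p) :
    HasSum (fun n => PowerSeries.coeff n (f : ℚ_[p]⟦X⟧) • L (tateX p ^ n)) (L f) := by
  simpa using (tate_hasSum p f).mapL L

lemma tateEval_summable (x : ℤ_[p]) (f : Tate p) :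
    Summable fun n => PowerSeries.coeff n (f : ℚ_[p]⟦X⟧) * (x : ℚ_[p]) ^ n := by
  refine NonarchimedeanAddGroup.summable_of_tendsto_cofinite_zero ?_
  rw [Nat.cofinite_eq_atTop]
  refine Filter.Tendsto.zero_mul_isBoundedUnder_le f.2 ?_
  refine Filter.isBoundedUnder_of ⟨1, fun n => ?_⟩
  simpa using pow_le_one₀ (norm_nonneg _) x.2

lemma padic_nonarchimedeanRing : NonarchimedeanRing ℚ_[p] where
  toIsTopologicalRing := inferInstance
  is_nonarchimedean := NonarchimedeanAddGroup.is_nonarchimedean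

lemma padic_tsum_mul_tsum {f g : ℕ → ℚ_[p]} (hf : Summable f) (hg : Summable g) :
    (∑' n, f n) * (∑' n, g n) = ∑' n, ∑ i ∈ Finset.HasAntidiagonal.antidiagonal n, f i.1 * g i.2 := by
  have := padic_nonarchimedeanRing p
  exact hf.tsum_mul_tsum_eq_tsum_sum_antidiagonal hg (hf.mul_of_nonarchimedean hg)

/-- Evaluation of an element of the Tate algebra at a `p`-adic integer. -/
def tateEvalHom (x : ℤ_[p]) : Tate p →ₐ[ℚ_[p]] ℚ_[p] where
  toFun f := ∑' n, PowerSeries.coeff n (f : ℚ_[p]⟦X⟧) * (x : ℚ_[p]) ^ n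
  map_one' := by
    rw [tsum_eq_single 0 fun n hn => by simp [PowerSeries.coeff_one, hn]]
    simp
  map_zero' := by simp
  map_add' f g := by
    simp only [Subalgebra.coe_add, map_add, add_mul]
    exact Summable.tsum_add (tateEval_summable p x f) (tateEval_summable p x g)
  map_mul' f g := by
    rw [padic_tsum_mul_tsum p (tateEval_summable p x f) (tateEval_summable p x g)]
    refine tsum_congr fun n => ?_
    rw [Subalgebra.coe_mul, PowerSeries.coeff_mul, Finset.sum_mul]
    refine Finset.sum_congr rfl fun i hi => ?_
    rw [← Finset.HasAntidiagonal.mem_antidiagonal.1 hi, pow_add]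
    ring
  commutes' r := by
    have : ((algebraMap ℚ_[p] (Tate p) r : Tate p) : ℚ_[p]⟦X⟧) = PowerSeries.C r := rfl
    rw [this, tsum_eq_single 0 fun n hn => by simp [PowerSeries.coeff_C, hn]]
    simp

lemma norm_tateEvalHom_le (x : ℤ_[p]) (f : Tate p) : ‖tateEvalHom p x f‖ ≤ ‖f‖ := by
  refine IsUltrametricDist.norm_tsum_le_of_forall_le_of_nonneg (norm_nonneg _) fun n => ?_
  rw [norm_mul, norm_pow]
  exact (mul_le_of_le_one_right (norm_nonneg _) (pow_le_one₀ (norm_nonneg _) x.2)).trans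
    (norm_coeff_le p f n)

/-- Evaluation at a `p`-adic integer, as a continuous linear functional. -/
def tateEval (x : ℤ_[p]) : Tate p →L[ℚ_[p]] ℚ_[p] :=
  (tateEvalHom p x).toLinearMap.mkContinuous 1 fun f => by
    simpa using norm_tateEvalHom_le p x f

lemma tateEval_apply (x : ℤ_[p]) (f : Tate p) : tateEval p x f = tateEvalHom p x f := rfl

lemma tateEvalHom_X (x : ℤ_[p]) : tateEvalHom p x (tateX p) = x := by
  change ∑' n, PowerSeries.coeff n (PowerSeries.X : ℚ_[p]⟦X⟧) * (x : ℚ_[p]) ^ n = x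
  rw [tsum_eq_single 1 fun n hn => by simp [PowerSeries.coeff_X, hn]]
  simp

/-- An element of the Tate algebra that vanishes on `ℤ_p` is zero. -/
lemma tate_eq_zero_of_tateEval (f : Tate p) (hf : ∀ x, tateEval p x f = 0) : f = 0 := by
  by_contra hne
  have hex : ∃ n, PowerSeries.coeff n (f : ℚ_[p]⟦X⟧) ≠ 0 := by
    by_contra! h
    exact hne (Subtype.ext (PowerSeries.ext h))
  classical
  set n := Nat.find hex with hn
  have hnz := Nat.find_spec hex
  have hlt : ∀ m < n, PowerSeries.coeff m (f : ℚ_[p]⟦X⟧) = 0 := fun m hm => by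
    simpa using Nat.find_min hex hm
  have hf2 : Filter.Tendsto (fun m => PowerSeries.coeff m (f : ℚ_[p]⟦X⟧)) Filter.atTop (𝓝 0) := f.2
  let h : Tate p := ⟨PowerSeries.mk fun m => PowerSeries.coeff (m + (n + 1)) (f : ℚ_[p]⟦X⟧), by
    change Filter.Tendsto (fun m => PowerSeries.coeff m (PowerSeries.mk _)) _ _
    simp only [PowerSeries.coeff_mk]
    exact (Filter.tendsto_add_atTop_iff_nat (n + 1)).2 hf2⟩
  have hh : ∀ i, PowerSeries.coeff i (h : ℚ_[p]⟦X⟧) =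
      PowerSeries.coeff (i + (n + 1)) (f : ℚ_[p]⟦X⟧) := fun i =>
    PowerSeries.coeff_mk i fun m => PowerSeries.coeff (m + (n + 1)) (f : ℚ_[p]⟦X⟧)
  set c := PowerSeries.coeff n (f : ℚ_[p]⟦X⟧) with hc
  -- Split off the lowest nonzero term: `c` is the first nonzero coefficient and `h` the tail beyond
  -- it.
  have hfac : f = tateX p ^ n * (algebraMap ℚ_[p] (Tate p) c + tateX p * h) := by
    ext m
    have : ((tateX p ^ n * (algebraMap ℚ_[p] (Tate p) c + tateX p * h) : Tate p) : ℚ_[p]⟦X⟧) =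
      PowerSeries.X ^ n * (PowerSeries.C c + PowerSeries.X * (h : ℚ_[p]⟦X⟧)) := rfl
    rw [this, PowerSeries.coeff_X_pow_mul']
    split_ifs with hm
    · obtain ⟨i, rfl⟩ := Nat.exists_eq_add_of_le hm
      rw [Nat.add_sub_cancel_left]
      rcases i with _ | i
      · simp [hc]
      · rw [map_add, PowerSeries.coeff_succ_X_mul, PowerSeries.coeff_C, if_neg (by omega), zero_add]
        rw [hh, show n + (i + 1) = i + (n + 1) by omega]
    · exact hlt m (not_le.1 hm)
  -- At the point `p ^ m` the factor `tateX ^ n` does not vanish, so `c = -p^m h(p^m)`; letting `m`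
  -- grow forces `c = 0`.
  have hev : ∀ m : ℕ, ‖c‖ ≤ ‖(p : ℚ_[p]) ^ m‖ * ‖h‖ := fun m => by
    have h1 := hf ((p : ℤ_[p]) ^ m)
    rw [tateEval_apply, hfac, map_mul, map_pow, map_add, map_mul, tateEvalHom_X,
      AlgHom.commutes] at h1
    have hp : (p : ℚ_[p]) ≠ 0 := by simpa using (Fact.out : p.Prime).ne_zero
    have h2 := (mul_eq_zero.1 h1).resolve_left (by push_cast; positivity)
    have h3 : c = -((p : ℚ_[p]) ^ m * tateEvalHom p ((p : ℤ_[p]) ^ m) h) := by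
      rw [← sub_eq_zero, sub_neg_eq_add]
      simpa using h2
    rw [h3, norm_neg, norm_mul]
    exact mul_le_mul_of_nonneg_left (norm_tateEvalHom_le p _ _) (norm_nonneg _)
  have hlim : Filter.Tendsto (fun m : ℕ => ‖(p : ℚ_[p]) ^ m‖ * ‖h‖) Filter.atTop (𝓝 (0 * ‖h‖)) := by
    refine Filter.Tendsto.mul_const _ ?_
    simpa using (tendsto_zero_iff_norm_tendsto_zero.1
      (tendsto_pow_atTop_nhds_zero_of_norm_lt_one (x := (p : ℚ_[p])) Padic.norm_p_lt_one))
  have := ge_of_tendsto' hlim hev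
  rw [zero_mul, norm_le_zero_iff] at this
  exact hnz this

/-- Reduces identities for the action to pointwise identities between Möbius transformations, which
avoids composing power series. -/
lemma tate_ext_eval {f g : Tate p} (h : ∀ x, tateEval p x f = tateEval p x g) : f = g :=
  sub_eq_zero.1 (tate_eq_zero_of_tateEval p _ fun x => by rw [map_sub, h, sub_self])

end tate

/-! ### The action on the Tate algebra: pointwise formula, multiplicativity, compatibility with
polynomials. -/

section action

variable (p : ℕ) [Fact p.Prime]

/-- The point `(dx-b)/(-cx+a)` of `ℤ_p` for a matrix `(a b; c d)` in `ℚ_p^× Σ₀(p)`. -/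
lemma exists_moebius {g : GL (Fin 2) ℚ_[p]} (hg : g ∈ qpSigma0 p) (x : ℤ_[p]) :
    ∃ y : ℤ_[p], g 0 0 - g 1 0 * x ≠ 0 ∧ y * (g 0 0 - g 1 0 * x) = g 1 1 * x - g 0 1 := by
  obtain ⟨u, M, ⟨hc, ha, -⟩, hM⟩ := hg
  have hu : (u : ℚ_[p]) ≠ 0 := u.ne_zero
  have hx : IsUnit (M 0 0 - M 1 0 * x) := by
    obtain ⟨c, hc⟩ := hc
    rw [PadicInt.isUnit_iff, hc]
    refine le_antisymm (PadicInt.norm_le_one _) (not_lt.1 fun hlt => ?_)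
    rw [PadicInt.norm_lt_one_iff_dvd] at hlt
    have h : (p : ℤ_[p]) ∣ M 0 0 := by
      have := dvd_add hlt (Dvd.intro (c * x) rfl : (p : ℤ_[p]) ∣ p * (c * x))
      ring_nf at this
      simpa using this
    exact (PadicInt.p_nonunit (p := p)) (isUnit_of_dvd_unit h ha)
  obtain ⟨v, hv⟩ := hx
  have hg : ∀ i j, g i j = u * (M i j : ℚ_[p]) := fun i j => by
    rw [hM]
    rfl
  have hvq : (M 0 0 : ℚ_[p]) - M 1 0 * x = ((v : ℤ_[p]) : ℚ_[p]) := by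
    rw [hv]
    push_cast
    rfl
  refine ⟨(M 1 1 * x - M 0 1) * ((v⁻¹ : ℤ_[p]ˣ) : ℤ_[p]), ?_, ?_⟩
  · rw [hg, hg, mul_assoc, ← mul_sub, hvq]
    refine mul_ne_zero hu ?_
    exact fun h => v.ne_zero (Subtype.ext h)
  · have h1 : (((v⁻¹ : ℤ_[p]ˣ) : ℤ_[p]) : ℚ_[p]) * ((v : ℤ_[p]) : ℚ_[p]) = 1 := by
      rw [← PadicInt.coe_mul, v.inv_mul, PadicInt.coe_one]
    simp only [hg]
    push_cast
    linear_combination (u : ℚ_[p]) * ((M 1 1 : ℚ_[p]) * x - M 0 1) *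
      ((((v⁻¹ : ℤ_[p]ˣ) : ℤ_[p]) : ℚ_[p]) * hvq + h1)

/-- After removal of the scalar, the constant term is a unit and the linear coefficient is divisible
by `p`, so the inverse is a geometric series with coefficients tending to zero. -/
lemma inv_linear_mem_tateSubalgebra {g : GL (Fin 2) ℚ_[p]} (hg : g ∈ qpSigma0 p) :
    g 0 0 ≠ 0 ∧ (PowerSeries.C (g 0 0) - PowerSeries.C (g 1 0) * PowerSeries.X)⁻¹ ∈
      tateSubalgebra p := by
  obtain ⟨u, M, ⟨hc, ha, -⟩, hM⟩ := hg
  have hu : (u : ℚ_[p]) ≠ 0 := u.ne_zero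
  have hg : ∀ i j, g i j = u * (M i j : ℚ_[p]) := fun i j => by
    rw [hM]
    rfl
  have ha' : ‖(M 0 0 : ℚ_[p])‖ = 1 := PadicInt.isUnit_iff.1 ha
  have hc' : ‖(M 1 0 : ℚ_[p])‖ < 1 := (PadicInt.norm_lt_one_iff_dvd _).2 hc
  have ha0 : (M 0 0 : ℚ_[p]) ≠ 0 := by
    intro h
    simp [h] at ha'
  refine ⟨by rw [hg]; exact mul_ne_zero hu ha0, ?_⟩
  have h := (tateSubalgebra p).smul_mem (inv_mem_tateUnitBall p ha' hc').1 ((u : ℚ_[p])⁻¹)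
  convert h using 1
  symm
  rw [PowerSeries.eq_inv_iff_mul_eq_one (by simp [hg, ha0])]
  have h1 := PowerSeries.inv_mul_cancel
    (PowerSeries.C (M 0 0 : ℚ_[p]) - PowerSeries.C (M 1 0 : ℚ_[p]) * PowerSeries.X)
    (by simpa using ha0)
  have h2 : PowerSeries.C ((u : ℚ_[p])⁻¹) * PowerSeries.C (u : ℚ_[p]) = 1 := by
    rw [← map_mul, inv_mul_cancel₀ hu, map_one]
  rw [PowerSeries.smul_eq_C_mul, hg, hg, map_mul, map_mul]
  linear_combination h1 + h2 * (PowerSeries.C (M 0 0 : ℚ_[p]) -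
    PowerSeries.C (M 1 0 : ℚ_[p]) * PowerSeries.X)⁻¹ * (PowerSeries.C (M 0 0 : ℚ_[p]) -
    PowerSeries.C (M 1 0 : ℚ_[p]) * PowerSeries.X)

lemma coeff_tateAct (k : ℕ) (g : qpSigma0 p) (f : Tate p) (m : ℕ) :
    PowerSeries.coeff m (tateAct p k g f : ℚ_[p]⟦X⟧) =
      ((g : GL (Fin 2) ℚ_[p]) : Matrix (Fin 2) (Fin 2) ℚ_[p]).det⁻¹ ^ (k / 2) *
        ∑' n, PowerSeries.coeff n (f : ℚ_[p]⟦X⟧) *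
          PowerSeries.coeff m (tateMonomial p k (g : GL (Fin 2) ℚ_[p]) n) := by
  have : (tateAct p k g f : ℚ_[p]⟦X⟧) =
      ((g : GL (Fin 2) ℚ_[p]) : Matrix (Fin 2) (Fin 2) ℚ_[p]).det⁻¹ ^ (k / 2) •
        tateSubst p k g f := rfl
  rw [this, PowerSeries.coeff_smul, tateSubst, PowerSeries.coeff_mk, smul_eq_mul]

lemma coe_tateAct_tateX_pow (k : ℕ) (g : qpSigma0 p) (n : ℕ) :
    (tateAct p k g (tateX p ^ n) : ℚ_[p]⟦X⟧) =
      ((g : GL (Fin 2) ℚ_[p]) : Matrix (Fin 2) (Fin 2) ℚ_[p]).det⁻¹ ^ (k / 2) •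
        tateMonomial p k (g : GL (Fin 2) ℚ_[p]) n := by
  ext m
  rw [coeff_tateAct, PowerSeries.coeff_smul, smul_eq_mul]
  congr 1
  have h : ∀ i, PowerSeries.coeff i ((tateX p ^ n : Tate p) : ℚ_[p]⟦X⟧) = if i = n then 1 else 0 :=
    fun i => by simpa using coeff_smul_tateX_pow p 1 n i
  rw [tsum_eq_single n fun i hi => by rw [h, if_neg hi, zero_mul], h, if_pos rfl, one_mul]

/-- The action on the Tate algebra is given by the expected formula at every point of `ℤ_p`. -/
lemma tateEval_tateAct (k : ℕ) (g : qpSigma0 p) {x y : ℤ_[p]}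
    (h0 : (g : GL (Fin 2) ℚ_[p]) 0 0 - (g : GL (Fin 2) ℚ_[p]) 1 0 * x ≠ 0)
    (hy : y * ((g : GL (Fin 2) ℚ_[p]) 0 0 - (g : GL (Fin 2) ℚ_[p]) 1 0 * x) =
      (g : GL (Fin 2) ℚ_[p]) 1 1 * x - (g : GL (Fin 2) ℚ_[p]) 0 1) (f : Tate p) :
    tateEval p x (tateAct p k g f) =
      ((g : GL (Fin 2) ℚ_[p]) : Matrix (Fin 2) (Fin 2) ℚ_[p]).det⁻¹ ^ (k / 2) *
        (((g : GL (Fin 2) ℚ_[p]) 0 0 - (g : GL (Fin 2) ℚ_[p]) 1 0 * x) ^ k * tateEval p y f) := by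
  obtain ⟨g, hg⟩ := g
  dsimp only at h0 hy ⊢
  obtain ⟨ha0, hI⟩ := inv_linear_mem_tateSubalgebra p hg
  -- `A`, `B` and `I` are `-cx+a`, `dx-b` and `(-cx+a)⁻¹` as elements of the Tate algebra, so that
  -- evaluation, a ring homomorphism, can be applied to the image `A^k (B I)^n` of a monomial.
  let A : Tate p := algebraMap ℚ_[p] (Tate p) (g 0 0) - algebraMap ℚ_[p] (Tate p) (g 1 0) * tateX p
  let B : Tate p := algebraMap ℚ_[p] (Tate p) (g 1 1) * tateX p - algebraMap ℚ_[p] (Tate p) (g 0 1)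
  let I : Tate p := ⟨_, hI⟩
  have hAI : A * I = 1 := Subtype.ext (PowerSeries.mul_inv_cancel
    (PowerSeries.C (g 0 0) - PowerSeries.C (g 1 0) * PowerSeries.X) (by simpa using ha0))
  have hmon : ∀ n, tateAct p k ⟨g, hg⟩ (tateX p ^ n) =
      (g : Matrix (Fin 2) (Fin 2) ℚ_[p]).det⁻¹ ^ (k / 2) • (A ^ k * (B * I) ^ n) := fun n => by
    ext1
    rw [coe_tateAct_tateX_pow]
    rfl
  have hA : tateEvalHom p x A = g 0 0 - g 1 0 * x := by
    simp only [A, map_sub, map_mul, AlgHom.commutes, tateEvalHom_X]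
    rfl
  have hB : tateEvalHom p x B = g 1 1 * x - g 0 1 := by
    simp only [B, map_sub, map_mul, AlgHom.commutes, tateEvalHom_X]
    rfl
  have hI' : tateEvalHom p x (B * I) = y := by
    have h1 : tateEvalHom p x A * tateEvalHom p x I = 1 := by rw [← map_mul, hAI, map_one]
    rw [map_mul, hB, ← hy, ← hA]
    linear_combination (y : ℚ_[p]) * h1
  -- Both sides are continuous and linear in `f`, so it is enough to compare their expansions term
  -- by term on monomials.
  have h1 := map_tate_hasSum p ((tateEval p x).comp (tateAct p k ⟨g, hg⟩)) f
  have h2 := (map_tate_hasSum p (tateEval p y) f).mul_left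
    ((g : Matrix (Fin 2) (Fin 2) ℚ_[p]).det⁻¹ ^ (k / 2) * (g 0 0 - g 1 0 * x) ^ k)
  have h3 : ∀ n, PowerSeries.coeff n (f : ℚ_[p]⟦X⟧) •
      ((tateEval p x).comp (tateAct p k ⟨g, hg⟩)) (tateX p ^ n) =
      ((g : Matrix (Fin 2) (Fin 2) ℚ_[p]).det⁻¹ ^ (k / 2) * (g 0 0 - g 1 0 * x) ^ k) *
        (PowerSeries.coeff n (f : ℚ_[p]⟦X⟧) • tateEval p y (tateX p ^ n)) := fun n => by
    rw [ContinuousLinearMap.comp_apply, hmon, tateEval_apply, tateEval_apply, map_smul, map_mul,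
      map_pow, map_pow, map_pow, hA, hI', tateEvalHom_X]
    simp only [smul_eq_mul]
    ring
  simp only [h3] at h1
  rw [← mul_assoc]
  exact h1.unique h2

/-- The action is multiplicative. -/
lemma tateAct_tateAct_eq (k : ℕ) {g₁ h₁ g₂ h₂ : qpSigma0 p}
    (h : (g₁ * h₁ : GL (Fin 2) ℚ_[p]) = g₂ * h₂) (f : Tate p) :
    tateAct p k g₁ (tateAct p k h₁ f) = tateAct p k g₂ (tateAct p k h₂ f) := by
  refine tate_ext_eval p fun x => ?_
  -- The value at `x` of the composite depends only on the product `g * h`: the factor `-cx+a` is a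
  -- cocycle and `z` is the image of `x` under the product. Thus `g * h` itself need not be known to
  -- lie in the set `qpSigma0`.
  have key : ∀ g h : qpSigma0 p, ∃ z : ℤ_[p],
      (g * h : GL (Fin 2) ℚ_[p]) 0 0 - (g * h : GL (Fin 2) ℚ_[p]) 1 0 * x ≠ 0 ∧
      z * ((g * h : GL (Fin 2) ℚ_[p]) 0 0 - (g * h : GL (Fin 2) ℚ_[p]) 1 0 * x) =
        (g * h : GL (Fin 2) ℚ_[p]) 1 1 * x - (g * h : GL (Fin 2) ℚ_[p]) 0 1 ∧
      tateEval p x (tateAct p k g (tateAct p k h f)) =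
        ((g * h : GL (Fin 2) ℚ_[p]) : Matrix (Fin 2) (Fin 2) ℚ_[p]).det⁻¹ ^ (k / 2) *
        (((g * h : GL (Fin 2) ℚ_[p]) 0 0 - (g * h : GL (Fin 2) ℚ_[p]) 1 0 * x) ^ k *
          tateEval p z f) := fun g h => by
    obtain ⟨y, hy0, hy⟩ := exists_moebius p g.2 x
    obtain ⟨z, hz0, hz⟩ := exists_moebius p h.2 y
    have hm : ∀ i j, (g * h : GL (Fin 2) ℚ_[p]) i j =
        (g : GL (Fin 2) ℚ_[p]) i 0 * (h : GL (Fin 2) ℚ_[p]) 0 j +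
        (g : GL (Fin 2) ℚ_[p]) i 1 * (h : GL (Fin 2) ℚ_[p]) 1 j := fun i j => by
      rw [Matrix.GeneralLinearGroup.coe_mul, Matrix.mul_apply, Fin.sum_univ_two]
    have hA : (g * h : GL (Fin 2) ℚ_[p]) 0 0 - (g * h : GL (Fin 2) ℚ_[p]) 1 0 * x =
        ((g : GL (Fin 2) ℚ_[p]) 0 0 - (g : GL (Fin 2) ℚ_[p]) 1 0 * x) *
        ((h : GL (Fin 2) ℚ_[p]) 0 0 - (h : GL (Fin 2) ℚ_[p]) 1 0 * y) := by
      rw [hm, hm]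
      linear_combination -((h : GL (Fin 2) ℚ_[p]) 1 0) * -hy
    refine ⟨z, ?_, ?_, ?_⟩
    · rw [hA]
      exact mul_ne_zero hy0 hz0
    · rw [hA, hm, hm]
      linear_combination ((g : GL (Fin 2) ℚ_[p]) 0 0 - (g : GL (Fin 2) ℚ_[p]) 1 0 * x) * hz +
        ((h : GL (Fin 2) ℚ_[p]) 1 1) * hy
    · rw [tateEval_tateAct p k g hy0 hy, tateEval_tateAct p k h hz0 hz, hA,
        Matrix.GeneralLinearGroup.coe_mul, Matrix.det_mul, mul_inv, mul_pow, mul_pow]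
      ring
  obtain ⟨z₁, hn₁, hz₁, e₁⟩ := key g₁ h₁
  obtain ⟨z₂, hn₂, hz₂, e₂⟩ := key g₂ h₂
  rw [e₁, e₂, h]
  rw [h] at hz₁
  have : z₁ = z₂ := by
    have h3 := mul_right_cancel₀ hn₂ (hz₁.trans hz₂.symm)
    exact Subtype.ext h3
  rw [this]

lemma tateEval_polyToTate (k : ℕ) (x : ℤ_[p]) (P : PolyLE p k) :
    tateEval p x (polyToTate p k P) = (P : ℚ_[p][X]).eval (x : ℚ_[p]) := by
  change ∑' n, PowerSeries.coeff n (((P : ℚ_[p][X]) : ℚ_[p]⟦X⟧)) * (x : ℚ_[p]) ^ n = _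
  rw [Polynomial.eval_eq_sum_range,
    tsum_eq_sum (s := Finset.range ((P : ℚ_[p][X]).natDegree + 1)) fun n hn => ?_]
  · simp
  · rw [Polynomial.coeff_coe, Polynomial.coeff_eq_zero_of_natDegree_lt, zero_mul]
    simpa [Nat.lt_succ_iff] using hn

/-- This equivariance of the inclusion of polynomials is what makes `piMap` equivariant. It is
checked at points of `ℤ_p`. -/
lemma tateAct_polyToTate (k : ℕ) (hk : Even k) (g : qpSigma0 p) (P : PolyLE p k) :
    tateAct p k g (polyToTate p k P) =
      polyToTate p k (polySlash p k (g : GL (Fin 2) ℚ_[p])⁻¹ P) := by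
  refine tate_ext_eval p fun x => ?_
  obtain ⟨y, hy0, hy⟩ := exists_moebius p g.2 x
  rw [tateEval_tateAct p k g hy0 hy, tateEval_polyToTate, tateEval_polyToTate]
  obtain ⟨g, hg⟩ := g
  dsimp only at hy0 hy ⊢
  set δ := (g : Matrix (Fin 2) (Fin 2) ℚ_[p]).det with hδ
  have hδ0 : δ ≠ 0 := g.det_ne_zero
  have hinv : ((g⁻¹ : GL (Fin 2) ℚ_[p]) : Matrix (Fin 2) (Fin 2) ℚ_[p]) =
      δ⁻¹ • !![g 1 1, -g 0 1; -g 1 0, g 0 0] := by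
    rw [Matrix.coe_units_inv, Matrix.inv_def, Matrix.adjugate_fin_two, Ring.inverse_eq_inv']
  have hdet : ((g⁻¹ : GL (Fin 2) ℚ_[p]) : Matrix (Fin 2) (Fin 2) ℚ_[p]).det = δ⁻¹ := by
    rw [Matrix.coe_units_inv, Matrix.det_nonsing_inv, Ring.inverse_eq_inv']
  have hslash : ((polySlash p k g⁻¹ P : PolyLE p k) : ℚ_[p][X]) =
      (((g⁻¹ : GL (Fin 2) ℚ_[p]) : Matrix (Fin 2) (Fin 2) ℚ_[p]).det⁻¹ ^ (k / 2)) •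
      ∑ i ∈ Finset.range (k + 1), (P : ℚ_[p][X]).coeff i •
        ((Polynomial.C (g⁻¹ 0 0) * Polynomial.X + Polynomial.C (g⁻¹ 0 1)) ^ i *
          (Polynomial.C (g⁻¹ 1 0) * Polynomial.X + Polynomial.C (g⁻¹ 1 1)) ^ (k - i)) := rfl
  have hdeg : (P : ℚ_[p][X]).natDegree < k + 1 := by
    have := Polynomial.mem_degreeLE.1 P.2
    exact Nat.lt_succ_of_le (Polynomial.natDegree_le_iff_degree_le.2 this)
  rw [hslash, Polynomial.eval_smul, hdet, hinv, Polynomial.eval_finsetSum,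
    Polynomial.eval_eq_sum_range' hdeg, inv_inv, smul_eq_mul, Finset.mul_sum, Finset.mul_sum,
    Finset.mul_sum]
  refine Finset.sum_congr rfl fun i hi => ?_
  have hi' : i + (k - i) = k := by
    have := Finset.mem_range.1 hi
    omega
  simp only [Polynomial.eval_smul, Polynomial.eval_mul, Polynomial.eval_pow, Polynomial.eval_add,
    Polynomial.eval_C, Polynomial.eval_X, Matrix.smul_apply, smul_eq_mul, Matrix.of_apply,
    Matrix.cons_val', Matrix.cons_val_zero, Matrix.cons_val_one, Matrix.cons_val_fin_one]
  have e1 : δ⁻¹ * g 1 1 * x + δ⁻¹ * -g 0 1 = δ⁻¹ * (y * (g 0 0 - g 1 0 * x)) := by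
    rw [hy]
    ring
  have e2 : δ⁻¹ * -g 1 0 * x + δ⁻¹ * g 0 0 = δ⁻¹ * (g 0 0 - g 1 0 * x) := by ring
  rw [e1, e2, mul_pow, mul_pow, mul_pow]
  obtain ⟨l, rfl⟩ := hk
  have hl : (l + l) / 2 = l := by omega
  -- Here the evenness of `k` enters: the entries of `g⁻¹` contribute `δ^(-2l)` and its determinant
  -- contributes `δ^l`, which leaves the normalization `δ^(-l)` of `tateAct`.
  have hd : δ⁻¹ ^ l = δ ^ l * (δ⁻¹ ^ i * δ⁻¹ ^ (l + l - i)) := by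
    rw [← pow_add, hi', pow_add, ← mul_assoc, ← mul_pow, mul_inv_cancel₀ hδ0, one_pow, one_mul]
  have hA : (g 0 0 - g 1 0 * (x : ℚ_[p])) ^ (l + l) =
      (g 0 0 - g 1 0 * (x : ℚ_[p])) ^ i * (g 0 0 - g 1 0 * (x : ℚ_[p])) ^ (l + l - i) := by
    rw [← pow_add, hi']
  rw [hl, hd, hA]
  ring

end action

/-! ### Norm estimates for the action, the truncation lift and the contraction. -/

section bounds

variable (p : ℕ) [Fact p.Prime]

/-- The constant `C` may depend on the degree `m`; for `(alpha p j)⁻¹` it decays with `m`, which is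
the point of the estimate. -/
lemma norm_coeff_tateAct_le (k : ℕ) (g : qpSigma0 p) (m : ℕ) {C : ℝ} (hC0 : 0 ≤ C)
    (hC : ∀ n, ‖PowerSeries.coeff m (tateMonomial p k (g : GL (Fin 2) ℚ_[p]) n)‖ ≤ C) (f : Tate p) :
    ‖PowerSeries.coeff m (tateAct p k g f : ℚ_[p]⟦X⟧)‖ ≤
      ‖((g : GL (Fin 2) ℚ_[p]) : Matrix (Fin 2) (Fin 2) ℚ_[p]).det⁻¹ ^ (k / 2)‖ * C * ‖f‖ := by
  rw [coeff_tateAct, norm_mul, mul_assoc]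
  refine mul_le_mul_of_nonneg_left ?_ (norm_nonneg _)
  refine IsUltrametricDist.norm_tsum_le_of_forall_le_of_nonneg (by positivity) fun n => ?_
  rw [norm_mul, mul_comm C]
  exact mul_le_mul (norm_coeff_le p f n) (hC n) (norm_nonneg _) (norm_nonneg _)

/-- The determinant is a unit and monomials go to power series with integral coefficients, because
the upper left entry is a unit and the lower left one is divisible by `p`. -/
lemma norm_tateAct_gamma0_le (k : ℕ) {σ : GL (Fin 2) ℚ_[p]} (hσ : σ ∈ gamma0 p) (f : Tate p) :
    ‖tateAct p k ⟨σ, gamma0_subset p hσ⟩ f‖ ≤ ‖f‖ := by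
  obtain ⟨τ, hc, rfl⟩ := id hσ
  have hentry : ∀ i j, Matrix.GeneralLinearGroup.map (PadicInt.Coe.ringHom (p := p)) τ i j =
      ((τ i j : ℤ_[p]) : ℚ_[p]) := fun i j => rfl
  have hdet : (Matrix.GeneralLinearGroup.map (PadicInt.Coe.ringHom (p := p)) τ :
      Matrix (Fin 2) (Fin 2) ℚ_[p]).det = ((τ : Matrix (Fin 2) (Fin 2) ℤ_[p]).det : ℚ_[p]) := by
    rw [Matrix.det_fin_two, Matrix.det_fin_two]
    simp only [hentry]
    push_cast
    rfl
  have hdu : IsUnit (τ : Matrix (Fin 2) (Fin 2) ℤ_[p]).det :=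
    (Matrix.isUnit_iff_isUnit_det _).1 τ.isUnit
  have ha : ‖((τ 0 0 : ℤ_[p]) : ℚ_[p])‖ = 1 := by
    refine le_antisymm (τ 0 0).2 (not_lt.1 fun hlt => ?_)
    have h1 : (p : ℤ_[p]) ∣ τ 0 0 := (PadicInt.norm_lt_one_iff_dvd _).1 hlt
    have h2 : (p : ℤ_[p]) ∣ (τ : Matrix (Fin 2) (Fin 2) ℤ_[p]).det := by
      rw [Matrix.det_fin_two]
      exact dvd_sub (h1.mul_right _) (hc.mul_left _)
    exact PadicInt.p_nonunit (isUnit_of_dvd_unit h2 hdu)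
  have hc' : ‖((τ 1 0 : ℤ_[p]) : ℚ_[p])‖ < 1 := (PadicInt.norm_lt_one_iff_dvd _).2 hc
  have hmem : ∀ n, tateMonomial p k
      (Matrix.GeneralLinearGroup.map (PadicInt.Coe.ringHom (p := p)) τ) n ∈ tateUnitBall p := by
    intro n
    rw [tateMonomial]
    simp only [hentry]
    refine mul_mem (pow_mem ?_ _) (pow_mem (mul_mem ?_ ?_) _)
    · have := linear_mem_tateUnitBall p (u := -(τ 1 0 : ℤ_[p])) (v := (τ 0 0 : ℤ_[p]))
        (by simpa using (τ 1 0).2) (τ 0 0).2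
      simpa [sub_eq_add_neg, add_comm] using this
    · have := linear_mem_tateUnitBall p (u := (τ 1 1 : ℤ_[p])) (v := -(τ 0 1 : ℤ_[p]))
        (τ 1 1).2 (by simpa using (τ 0 1).2)
      simpa [sub_eq_add_neg] using this
    · exact inv_mem_tateUnitBall p ha hc'
  refine tate_norm_le p _ (norm_nonneg _) fun m => ?_
  refine (norm_coeff_tateAct_le p k ⟨_, gamma0_subset p hσ⟩ m zero_le_one
    (fun n => (hmem n).2 m) f).trans ?_
  have h1 : ‖((τ : Matrix (Fin 2) (Fin 2) ℤ_[p]).det : ℚ_[p])‖ = 1 := PadicInt.isUnit_iff.1 hdu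
  rw [hdet, norm_pow, norm_inv, h1]
  simp

lemma alpha_inv_eq (j : ℕ) : ((alpha p j)⁻¹ : GL (Fin 2) ℚ_[p]) =
    !![(p : ℚ_[p])⁻¹, -(j : ℚ_[p]) * (p : ℚ_[p])⁻¹; 0, 1] := by
  have hp : (p : ℚ_[p]) ≠ 0 := by simpa using (Fact.out : p.Prime).ne_zero
  rw [Matrix.coe_units_inv, alpha]
  refine Matrix.inv_eq_right_inv ?_
  ext i j
  fin_cases i <;> fin_cases j <;>
    simp [Matrix.GeneralLinearGroup.mkOfDetNeZero, Matrix.mul_apply, hp, mul_comm]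

/-- This is `p^(-k) (px + j)^n`, written through `rescale` so that the factor `p^m` in the
coefficient of degree `m` becomes visible. -/
lemma tateMonomial_alpha_inv (k j n : ℕ) :
    tateMonomial p k ((alpha p j)⁻¹ : GL (Fin 2) ℚ_[p]) n =
      PowerSeries.C ((p : ℚ_[p])⁻¹ ^ k) *
        PowerSeries.rescale (p : ℚ_[p]) ((PowerSeries.C 1 * PowerSeries.X +
          PowerSeries.C (j : ℚ_[p])) ^ n) := by
  have hp : (p : ℚ_[p]) ≠ 0 := by simpa using (Fact.out : p.Prime).ne_zero
  have hinv : (PowerSeries.C ((p : ℚ_[p])⁻¹) - PowerSeries.C (0 : ℚ_[p]) * PowerSeries.X)⁻¹ =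
      PowerSeries.C (p : ℚ_[p]) := by
    symm
    rw [PowerSeries.eq_inv_iff_mul_eq_one (by simpa using hp), map_zero, zero_mul, sub_zero,
      ← map_mul, mul_inv_cancel₀ hp, map_one]
  have hpp : PowerSeries.C (p : ℚ_[p]) * PowerSeries.C ((p : ℚ_[p])⁻¹) = 1 := by
    rw [← map_mul, mul_inv_cancel₀ hp, map_one]
  rw [alpha_inv_eq, tateMonomial]
  simp only [Matrix.of_apply, Matrix.cons_val', Matrix.cons_val_zero, Matrix.cons_val_one,
    Matrix.cons_val_fin_one]
  have hC : ∀ r : ℚ_[p], PowerSeries.rescale (p : ℚ_[p]) (PowerSeries.C r) = PowerSeries.C r :=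
    fun r => by
      ext m
      rw [PowerSeries.coeff_rescale, PowerSeries.coeff_C]
      split_ifs with hm <;> simp [hm]
  rw [hinv, map_pow, map_pow, map_one, one_mul, map_add, PowerSeries.rescale_X, hC, map_zero,
    zero_mul, sub_zero, map_mul, map_neg]
  congr 2
  linear_combination PowerSeries.C (j : ℚ_[p]) * hpp

/-- The source of the contraction. The determinant contributes `p^(k/2)`, the automorphy factor
`p^(-k)` and the rescaling `p^m`; for `m > k` the total exponent `m - k/2` is at least `1`. -/
lemma norm_coeff_tateAct_alpha_inv_le {k : ℕ} (hk : Even k) (j m : ℕ) (hm : k < m) (f : Tate p) :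
    ‖PowerSeries.coeff m (tateAct p k ⟨(alpha p j)⁻¹, alpha_inv_mem p j⟩ f : ℚ_[p]⟦X⟧)‖ ≤
      ‖(p : ℚ_[p])‖ * ‖f‖ := by
  have hp : (p : ℚ_[p]) ≠ 0 := by simpa using (Fact.out : p.Prime).ne_zero
  have hp0 : ‖(p : ℚ_[p])‖ ≠ 0 := by simpa using hp
  have hp1 : ‖(p : ℚ_[p])‖ ≤ 1 := Padic.norm_p_lt_one.le
  have hmem : ∀ n, (PowerSeries.C 1 * PowerSeries.X + PowerSeries.C (j : ℚ_[p])) ^ n ∈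
      tateUnitBall p := fun n => pow_mem (linear_mem_tateUnitBall p (by simp)
        (by simpa using Padic.norm_int_le_one (p := p) (j : ℤ))) n
  refine (norm_coeff_tateAct_le p k ⟨_, alpha_inv_mem p j⟩ m
    (C := ‖(p : ℚ_[p])‖⁻¹ ^ k * ‖(p : ℚ_[p])‖ ^ m) (by positivity) (fun n => ?_) f).trans ?_
  · dsimp only
    rw [tateMonomial_alpha_inv, PowerSeries.coeff_C_mul, PowerSeries.coeff_rescale, norm_mul,
      norm_mul, norm_pow, norm_pow, norm_inv]
    refine mul_le_mul_of_nonneg_left ?_ (by positivity)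
    exact mul_le_of_le_one_right (by positivity) ((hmem n).2 m)
  · refine mul_le_mul_of_nonneg_right ?_ (norm_nonneg _)
    dsimp only
    rw [alpha_inv_eq, Matrix.det_fin_two]
    simp only [Matrix.of_apply, Matrix.cons_val', Matrix.cons_val_zero, Matrix.cons_val_one,
      Matrix.cons_val_fin_one, mul_one, mul_zero, sub_zero, inv_inv, norm_pow]
    obtain ⟨l, rfl⟩ := hk
    rw [show (l + l) / 2 = l by omega]
    obtain ⟨i, rfl⟩ := Nat.exists_eq_add_of_lt hm
    calc ‖(p : ℚ_[p])‖ ^ l * (‖(p : ℚ_[p])‖⁻¹ ^ (l + l) * ‖(p : ℚ_[p])‖ ^ (l + l + i + 1))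
        = ‖(p : ℚ_[p])‖ ^ l * ‖(p : ℚ_[p])‖ ^ i * ‖(p : ℚ_[p])‖ *
          (‖(p : ℚ_[p])‖⁻¹ * ‖(p : ℚ_[p])‖) ^ (l + l) := by ring
      _ ≤ ‖(p : ℚ_[p])‖ := by
        rw [inv_mul_cancel₀ hp0, one_pow, mul_one]
        refine mul_le_of_le_one_left (norm_nonneg _) ?_
        exact mul_le_one₀ (pow_le_one₀ (norm_nonneg _) hp1) (by positivity)
          (pow_le_one₀ (norm_nonneg _) hp1)

/-- The truncation of an element of the Tate algebra in degree `k`. -/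
def tateTrunc (k : ℕ) : Tate p →ₗ[ℚ_[p]] PolyLE p k where
  toFun f := ⟨PowerSeries.trunc (k + 1) (f : ℚ_[p]⟦X⟧), by
    rw [Polynomial.mem_degreeLE]
    exact Polynomial.degree_le_of_natDegree_le
      (Nat.lt_succ_iff.1 (PowerSeries.natDegree_trunc_lt (f : ℚ_[p]⟦X⟧) k))⟩
  map_add' f g := by
    ext1
    simp
  map_smul' r f := by
    ext m
    simp [PowerSeries.coeff_trunc]

lemma coeff_polyToTate_tateTrunc (k : ℕ) (f : Tate p) (m : ℕ) :
    PowerSeries.coeff m (polyToTate p k (tateTrunc p k f) : ℚ_[p]⟦X⟧) =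
      if m < k + 1 then PowerSeries.coeff m (f : ℚ_[p]⟦X⟧) else 0 := by
  change PowerSeries.coeff m
    ((PowerSeries.trunc (k + 1) (f : ℚ_[p]⟦X⟧) : ℚ_[p][X]) : ℚ_[p]⟦X⟧) = _
  rw [Polynomial.coeff_coe, PowerSeries.coeff_trunc]

lemma norm_polyToTate_tateTrunc_le (k : ℕ) (f : Tate p) :
    ‖polyToTate p k (tateTrunc p k f)‖ ≤ ‖f‖ := by
  refine tate_norm_le p _ (norm_nonneg _) fun m => ?_
  rw [coeff_polyToTate_tateTrunc]
  split_ifs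
  · exact norm_coeff_le p f m
  · simp

lemma polyToTate_injective (k : ℕ) : Function.Injective (polyToTate p k) := by
  intro P Q h
  ext m
  have : PowerSeries.coeff m (polyToTate p k P : ℚ_[p]⟦X⟧) =
    PowerSeries.coeff m (polyToTate p k Q : ℚ_[p]⟦X⟧) := by rw [h]
  simpa [polyToTate] using this

lemma tateTrunc_polyToTate (k : ℕ) (P : PolyLE p k) : tateTrunc p k (polyToTate p k P) = P := by
  refine polyToTate_injective p k ?_
  ext m
  rw [coeff_polyToTate_tateTrunc]
  split_ifs with hm
  · rfl
  · change 0 = PowerSeries.coeff m (((P : ℚ_[p][X]) : ℚ_[p]⟦X⟧))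
    rw [Polynomial.coeff_coe, Polynomial.coeff_eq_zero_of_degree_lt]
    refine (Polynomial.mem_degreeLE.1 P.2).trans_lt ?_
    exact_mod_cast (by omega : k < m)

/-- Only the `k + 1` lowest coefficients of `f` enter, and each is bounded by `‖f‖`. -/
lemma exists_bound_vk (k : ℕ) (ω : Vk p k) : ∃ C, ∀ f : Tate p, ‖ω (tateTrunc p k f)‖ ≤ C * ‖f‖ := by
  let e : ℕ → PolyLE p k := fun i => tateTrunc p k (tateX p ^ i)
  have hsum : ∀ f : Tate p, tateTrunc p k f =
      ∑ i ∈ Finset.range (k + 1), PowerSeries.coeff i (f : ℚ_[p]⟦X⟧) • e i := fun f => by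
    refine polyToTate_injective p k ?_
    ext m
    rw [coeff_polyToTate_tateTrunc, map_sum, coe_tate_sum, map_sum]
    have h : ∀ i, PowerSeries.coeff m (polyToTate p k (PowerSeries.coeff i (f : ℚ_[p]⟦X⟧) • e i) :
        ℚ_[p]⟦X⟧) = if m < k + 1 then
          (if m = i then PowerSeries.coeff i (f : ℚ_[p]⟦X⟧) else 0) else 0 := fun i => by
      rw [← map_smul, coeff_polyToTate_tateTrunc, coeff_smul_tateX_pow]
    simp only [h]
    split_ifs with hm
    · rw [Finset.sum_ite_eq, if_pos (Finset.mem_range.2 hm)]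
    · simp
  refine ⟨∑ i ∈ Finset.range (k + 1), ‖ω (e i)‖, fun f => ?_⟩
  rw [hsum, map_sum, Finset.sum_mul]
  refine (norm_sum_le _ _).trans (Finset.sum_le_sum fun i _ => ?_)
  rw [map_smul, norm_smul, mul_comm]
  exact mul_le_mul_of_nonneg_left (norm_coeff_le p f i) (norm_nonneg _)

/-- The section of `π` given by truncation. -/
def vkLift (k : ℕ) (ω : Vk p k) : Dk p :=
  (ω ∘ₗ tateTrunc p k).mkContinuousOfExistsBound (exists_bound_vk p k ω)

lemma vkLift_apply (k : ℕ) (ω : Vk p k) (f : Tate p) : vkLift p k ω f = ω (tateTrunc p k f) := rfl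

lemma piMap_apply (k : ℕ) (ω : Dk p) (P : PolyLE p k) :
    piMap p k ω P = ω (polyToTate p k P) := rfl

lemma piMap_vkLift (k : ℕ) (ω : Vk p k) : piMap p k (vkLift p k ω) = ω := by
  ext P
  rw [piMap_apply, vkLift_apply, tateTrunc_polyToTate]

/-- Truncation does not increase the Gauss norm. This controls how the norm of the truncation lift
changes under the Iwahori group, although the lift is not equivariant. -/
lemma norm_vkLift_piMap_le (k : ℕ) (ω : Dk p) : ‖vkLift p k (piMap p k ω)‖ ≤ ‖ω‖ := by
  refine ContinuousLinearMap.opNorm_le_bound _ (norm_nonneg _) fun f => ?_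
  rw [vkLift_apply, piMap_apply]
  exact (ω.le_opNorm _).trans
    (mul_le_mul_of_nonneg_left (norm_polyToTate_tateTrunc_le p k f) (norm_nonneg _))

lemma dkAct_apply (k : ℕ) (g : qpSigma0 p) (ω : Dk p) (f : Tate p) :
    dkAct p k g ω f = ω (tateAct p k g f) := rfl

lemma continuous_dkAct (k : ℕ) (g : qpSigma0 p) : Continuous (dkAct p k g) := by
  change Continuous fun ω : Dk p => ω.comp (tateAct p k g)
  fun_prop

lemma norm_dkAct_le (k : ℕ) (g : qpSigma0 p) (ω : Dk p) :
    ‖dkAct p k g ω‖ ≤ ‖tateAct p k g‖ * ‖ω‖ := by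
  rw [mul_comm]
  exact ContinuousLinearMap.opNorm_comp_le _ _

/-- The factors act in the opposite order to `tateAct_tateAct_eq`, as the dual action is a right
action. -/
lemma dkAct_dkAct_eq (k : ℕ) {g₁ h₁ g₂ h₂ : qpSigma0 p}
    (h : (g₁ * h₁ : GL (Fin 2) ℚ_[p]) = g₂ * h₂) (ω : Dk p) :
    dkAct p k h₁ (dkAct p k g₁ ω) = dkAct p k h₂ (dkAct p k g₂ ω) := by
  ext f
  simp only [dkAct_apply]
  rw [tateAct_tateAct_eq p k h]

lemma piMap_dkAct {k : ℕ} (hk : Even k) (g : qpSigma0 p) (ω : Dk p) :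
    piMap p k (dkAct p k g ω) = vkAct p k g (piMap p k ω) := by
  ext P
  rw [piMap_apply, dkAct_apply, tateAct_polyToTate p k hk]
  rfl

lemma norm_dkAct_gamma0_le (k : ℕ) {σ : GL (Fin 2) ℚ_[p]} (hσ : σ ∈ gamma0 p) (ω : Dk p) :
    ‖dkAct p k ⟨σ, gamma0_subset p hσ⟩ ω‖ ≤ ‖ω‖ := by
  refine ContinuousLinearMap.opNorm_le_bound _ (norm_nonneg _) fun f => ?_
  rw [dkAct_apply]
  exact (ω.le_opNorm _).trans
    (mul_le_mul_of_nonneg_left (norm_tateAct_gamma0_le p k hσ f) (norm_nonneg _))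

/-- On distributions that kill the polynomials of degree at most `k`, the operator `U_p` is a
contraction after division by `p^(k/2)`. -/
lemma norm_sum_dkAct_alpha_inv_le {k : ℕ} (hk : Even k) (s : Finset ℕ) (ω : ℕ → Dk p)
    (hω : ∀ j, piMap p k (ω j) = 0) {C : ℝ} (hC0 : 0 ≤ C) (hC : ∀ j, ‖ω j‖ ≤ C) :
    ‖∑ j ∈ s, dkAct p k ⟨(alpha p j)⁻¹, alpha_inv_mem p j⟩ (ω j)‖ ≤ ‖(p : ℚ_[p])‖ * C := by
  refine ContinuousLinearMap.opNorm_le_bound _ (by positivity) fun f => ?_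
  rw [sum_apply]
  refine IsUltrametricDist.norm_sum_le_of_forall_le_of_nonneg (by positivity) fun j _ => ?_
  rw [dkAct_apply]
  set h := tateAct p k ⟨(alpha p j)⁻¹, alpha_inv_mem p j⟩ f with hh
  -- The part of `h` of degree at most `k` is invisible to `ω j`; what remains carries the factor
  -- `p`.
  have h1 : ω j h = ω j (h - polyToTate p k (tateTrunc p k h)) := by
    rw [map_sub, ← piMap_apply, hω, LinearMap.zero_apply, sub_zero]
  have h2 : ‖h - polyToTate p k (tateTrunc p k h)‖ ≤ ‖(p : ℚ_[p])‖ * ‖f‖ := by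
    refine tate_norm_le p _ (by positivity) fun m => ?_
    rw [Subalgebra.coe_sub, map_sub, coeff_polyToTate_tateTrunc]
    split_ifs with hm
    · rw [sub_self, norm_zero]
      positivity
    · rw [sub_zero]
      exact norm_coeff_tateAct_alpha_inv_le p hk j m (by omega) f
  rw [h1]
  refine ((ω j).le_opNorm _).trans ?_
  calc ‖ω j‖ * ‖h - polyToTate p k (tateTrunc p k h)‖ ≤ C * (‖(p : ℚ_[p])‖ * ‖f‖) :=
        mul_le_mul (hC j) h2 (norm_nonneg _) hC0
    _ = _ := by ring

end bounds

/-! ### The Iwahori group and the matrices `α_j`. -/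

section iwahori

variable (p : ℕ) [Fact p.Prime]

/-- Modulo `p` the matrix is upper triangular and invertible, so both diagonal entries are units. -/
lemma exists_matrix_of_mem_gamma0 {g : GL (Fin 2) ℚ_[p]} (hg : g ∈ gamma0 p) :
    ∃ M : Matrix (Fin 2) (Fin 2) ℤ_[p], (p : ℤ_[p]) ∣ M 1 0 ∧ IsUnit M.det ∧ IsUnit (M 0 0) ∧
      IsUnit (M 1 1) ∧ ∀ i j, g i j = (M i j : ℚ_[p]) := by
  obtain ⟨τ, hc, rfl⟩ := hg
  have hdu : IsUnit (τ : Matrix (Fin 2) (Fin 2) ℤ_[p]).det :=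
    (Matrix.isUnit_iff_isUnit_det _).1 τ.isUnit
  have key : ∀ x : ℤ_[p], ((p : ℤ_[p]) ∣ x → (p : ℤ_[p]) ∣
      (τ : Matrix (Fin 2) (Fin 2) ℤ_[p]).det) → IsUnit x := fun x hx => by
    by_contra h
    have h1 : (p : ℤ_[p]) ∣ x := by
      rw [← PadicInt.norm_lt_one_iff_dvd]
      exact lt_of_le_of_ne (PadicInt.norm_le_one _) fun h2 => h (PadicInt.isUnit_iff.2 h2)
    exact PadicInt.p_nonunit (isUnit_of_dvd_unit (hx h1) hdu)
  refine ⟨τ, hc, hdu, key _ fun h => ?_, key _ fun h => ?_, fun i j => rfl⟩ <;>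
    rw [Matrix.det_fin_two]
  · exact dvd_sub (h.mul_right _) (hc.mul_left _)
  · exact dvd_sub (h.mul_left _) (hc.mul_left _)

lemma alpha_eq (j : ℕ) : (alpha p j : Matrix (Fin 2) (Fin 2) ℚ_[p]) =
    !![(p : ℚ_[p]), (j : ℚ_[p]); 0, 1] := rfl

lemma exists_digit (w z : ℤ_[p]) (hz : IsUnit z) : ∃ e < p, (p : ℤ_[p]) ∣ w - e * z := by
  obtain ⟨v, rfl⟩ := hz
  obtain ⟨h1, h2⟩ := PadicInt.zmodRepr_spec (w * ((v⁻¹ : ℤ_[p]ˣ) : ℤ_[p]))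
  refine ⟨_, h1, ?_⟩
  rw [PadicInt.maximalIdeal_eq_span_p, Ideal.mem_span_singleton] at h2
  have := h2.mul_right (v : ℤ_[p])
  rwa [sub_mul, mul_assoc, v.inv_mul, mul_one] at this

/-- The Iwahori group permutes the cosets of the matrices `α_j`. -/
lemma exists_gamma0_mul_alpha {σ : GL (Fin 2) ℚ_[p]} (hσ : σ ∈ gamma0 p) :
    ∃ (e : ℕ → ℕ) (τ : ℕ → GL (Fin 2) ℚ_[p]), (∀ j, e j < p) ∧ (∀ j, τ j ∈ gamma0 p) ∧
      (∀ j, σ * alpha p j = alpha p (e j) * τ j) ∧ Set.InjOn e (Finset.range p) := by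
  obtain ⟨M, ⟨c, hc⟩, hdet, ha, hd, hM⟩ := exists_matrix_of_mem_gamma0 p hσ
  have hu : ∀ j : ℕ, IsUnit (M 1 0 * j + M 1 1) := fun j => by
    by_contra h
    have h1 : M 1 0 * j + M 1 1 ∈ IsLocalRing.maximalIdeal ℤ_[p] := h
    have h2 : M 1 0 * j ∈ IsLocalRing.maximalIdeal ℤ_[p] := by
      rw [PadicInt.maximalIdeal_eq_span_p, Ideal.mem_span_singleton, hc]
      exact (Dvd.intro _ rfl).mul_right _
    have h3 := Ideal.sub_mem _ h1 h2
    rw [add_sub_cancel_left] at h3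
    exact h3 hd
  -- Comparing `σ α_j` with `α_e τ` fixes the bottom row of `τ` as that of `σ α_j`; the upper right
  -- entry is then integral exactly when `e` is the residue of `(aj+b)/(cj+d)` modulo `p`, and `q j`
  -- is that entry.
  choose e he q hq using fun j : ℕ => exists_digit p (M 0 0 * j + M 0 1) (M 1 0 * j + M 1 1) (hu j)
  have hτ : ∀ j, IsUnit (!![M 0 0 - e j * M 1 0, q j; p * M 1 0, M 1 0 * j + M 1 1]).det := by
    intro j
    convert hdet using 1
    rw [Matrix.det_fin_two, Matrix.det_fin_two]
    simp only [Matrix.of_apply, Matrix.cons_val', Matrix.cons_val_zero, Matrix.cons_val_one,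
      Matrix.cons_val_fin_one]
    linear_combination (M 1 0) * hq j
  refine ⟨e, fun j => Matrix.GeneralLinearGroup.map (PadicInt.Coe.ringHom (p := p))
    (Matrix.GeneralLinearGroup.mk'' _ (hτ j)), he, fun j => ?_, fun j => ?_, ?_⟩
  · exact ⟨_, Dvd.intro _ rfl, rfl⟩
  · have hq' : (M 0 0 : ℚ_[p]) * j + M 0 1 - e j * (M 1 0 * j + M 1 1) = p * q j := by
      exact_mod_cast congrArg (fun z : ℤ_[p] => (z : ℚ_[p])) (hq j)
    have hent : ∀ i l, Matrix.GeneralLinearGroup.map (PadicInt.Coe.ringHom (p := p))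
        (Matrix.GeneralLinearGroup.mk'' _ (hτ j)) i l =
      ((!![M 0 0 - e j * M 1 0, q j; p * M 1 0, M 1 0 * j + M 1 1] i l : ℤ_[p]) : ℚ_[p]) :=
      fun i l => rfl
    ext i l
    rw [Matrix.GeneralLinearGroup.coe_mul, Matrix.GeneralLinearGroup.coe_mul, Matrix.mul_apply,
      Matrix.mul_apply, Fin.sum_univ_two, Fin.sum_univ_two, alpha_eq, alpha_eq]
    simp only [hent, hM]
    fin_cases i <;> fin_cases l <;> simp
    · ring
    · linear_combination hq'
    · ring
  -- If `e i = e j`, subtracting the two congruences gives `p ∣ a (i - j)`, because `p ∣ c`; and `a`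
  -- is a unit.
  · intro i hi j hj hij
    have h1 : (p : ℤ_[p]) ∣ ((i : ℤ) - (j : ℤ) : ℤ) := by
      have h2 : (p : ℤ_[p]) ∣ M 0 0 * ((i : ℤ) - (j : ℤ) : ℤ) := by
        refine ⟨q i - q j + e i * c * (i - j), ?_⟩
        have h3 := hq i
        rw [hij] at h3 ⊢
        push_cast
        linear_combination h3 - hq j + (e j : ℤ_[p]) * (i - j) * hc
      exact (IsUnit.dvd_mul_left ha).1 h2
    rw [← PadicInt.norm_lt_one_iff_dvd, PadicInt.norm_int_lt_one_iff_dvd] at h1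
    have hi' := Finset.mem_range.1 hi
    have hj' := Finset.mem_range.1 hj
    have := Int.eq_zero_of_abs_lt_dvd h1 (by rw [abs_lt]; omega)
    omega

lemma sum_range_comp_injOn {V : Type*} [AddCommMonoid V] {n : ℕ} {e : ℕ → ℕ} (he : ∀ j, e j < n)
    (hinj : Set.InjOn e (Finset.range n)) (F : ℕ → V) :
    ∑ j ∈ Finset.range n, F (e j) = ∑ j ∈ Finset.range n, F j := by
  classical
  rw [← Finset.sum_image (f := F) (g := e) hinj]
  congr 1
  refine Finset.eq_of_subset_of_card_le (fun i hi => ?_) ?_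
  · obtain ⟨j, -, rfl⟩ := Finset.mem_image.1 hi
    exact Finset.mem_range.2 (he j)
  · rw [Finset.card_image_of_injOn hinj]

end iwahori

/-! ### The control theorem, assuming finitely many double cosets. -/

section control

variable (p : ℕ) [Fact p.Prime]

/-- The operator `p^(-k/2) U_p`. -/
def UpNorm {V : Type} [AddCommGroup V] [Module ℚ_[p] V] (act : qpSigma0 p → V →ₗ[ℚ_[p]] V)
    (φ : GL (Fin 2) ℚ_[p] → V) (g : GL (Fin 2) ℚ_[p]) : V :=
  ∑ j ∈ Finset.range p, act ⟨(alpha p j)⁻¹, alpha_inv_mem p j⟩ (φ (g * alpha p j))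

lemma mem_eigenspace_Up_iff (k : ℕ) {V : Type} [AddCommGroup V] [Module ℚ_[p] V]
    (act : qpSigma0 p → V →ₗ[ℚ_[p]] V) (φ : GL (Fin 2) ℚ_[p] → V) :
    φ ∈ Module.End.eigenspace (Up p k act) ((p : ℚ_[p]) ^ (k / 2)) ↔ UpNorm p act φ = φ := by
  have hp : (p : ℚ_[p]) ^ (k / 2) ≠ 0 :=
    pow_ne_zero _ (by simpa using (Fact.out : p.Prime).ne_zero)
  have h : Up p k act φ = (p : ℚ_[p]) ^ (k / 2) • UpNorm p act φ := rfl
  rw [Module.End.mem_eigenspace_iff, h]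
  exact ⟨fun h => smul_right_injective _ hp h, fun h => by rw [h]⟩

lemma piMap_UpNorm {k : ℕ} (hk : Even k) (Φ : GL (Fin 2) ℚ_[p] → Dk p) (g : GL (Fin 2) ℚ_[p]) :
    piMap p k (UpNorm p (dkAct p k) Φ g) =
      UpNorm p (fun g => vkAct p k g) (fun g => piMap p k (Φ g)) g := by
  simp only [UpNorm, map_sum, piMap_dkAct p hk]

lemma norm_UpNorm_le {k : ℕ} (hk : Even k) (Φ : GL (Fin 2) ℚ_[p] → Dk p)
    (hΦ : ∀ g, piMap p k (Φ g) = 0) {C : ℝ} (hC : ∀ g, ‖Φ g‖ ≤ C) (g : GL (Fin 2) ℚ_[p]) :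
    ‖UpNorm p (dkAct p k) Φ g‖ ≤ ‖(p : ℚ_[p])‖ * C :=
  norm_sum_dkAct_alpha_inv_le p hk _ (fun j => Φ (g * alpha p j)) (fun _ => hΦ _)
    ((norm_nonneg _).trans (hC 1)) fun _ => hC _

/-- `Γ \ GL₂(ℚ_p) / ℚ_p^× Γ₀(pℤ_p)` is finite. -/
def FiniteDoubleCosets (Γ : Subgroup (GL (Fin 2) ℚ_[p])) : Prop :=
  ∃ S : Set (GL (Fin 2) ℚ_[p]), S.Finite ∧ ∀ g, ∃ (u : ℚ_[p]ˣ), ∃ γ ∈ Γ, ∃ s ∈ S, ∃ σ ∈ gamma0 p,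
    g = Matrix.GeneralLinearGroup.scalar (Fin 2) u * γ * (s * σ)

variable {p} {Γ : Subgroup (GL (Fin 2) ℚ_[p])}

/-- On the right an inequality suffices: the maximum over representatives bounds `F` everywhere. -/
lemma exists_bound_of_finite (hΓ : FiniteDoubleCosets p Γ) (F : GL (Fin 2) ℚ_[p] → ℝ)
    (hleft : ∀ (u : ℚ_[p]ˣ), ∀ γ ∈ Γ, ∀ g,
      F (Matrix.GeneralLinearGroup.scalar (Fin 2) u * γ * g) = F g)
    (hright : ∀ g, ∀ σ ∈ gamma0 p, F (g * σ) ≤ F g) : ∃ C, ∀ g, F g ≤ C := by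
  obtain ⟨S, hS, h⟩ := hΓ
  obtain ⟨C, hC⟩ := (hS.image F).bddAbove
  refine ⟨C, fun g => ?_⟩
  obtain ⟨u, γ, hγ, s, hs, σ, hσ, rfl⟩ := h g
  rw [hleft u γ hγ]
  exact (hright s σ hσ).trans (hC (Set.mem_image_of_mem F hs))

/-- Any bound can be improved by the factor `r`, so `r ^ n * C` is a bound for every `n`. It serves
both for the kernel of specialization and for the defect of equivariance. -/
lemma le_zero_of_le_mul_self {ι : Type*} {F : ι → ℝ} {r C : ℝ} (hr0 : 0 ≤ r) (hr : r < 1)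
    (hC : ∀ i, F i ≤ C)
    (h : ∀ C, (∀ i, F i ≤ C) → ∀ i, F i ≤ r * C) (i : ι) : F i ≤ 0 := by
  have hn : ∀ n : ℕ, ∀ i, F i ≤ r ^ n * C := fun n => by
    induction n with
    | zero => simpa using hC
    | succ n ih =>
      intro i
      rw [pow_succ', mul_assoc]
      exact h _ ih i
  have hlim := (tendsto_pow_atTop_nhds_zero_of_lt_one hr0 hr).mul_const C
  rw [zero_mul] at hlim
  exact ge_of_tendsto' hlim fun n => hn n i

variable {k : ℕ}

lemma specialization_mem_padicEigen (hk : Even k) {Φ : GL (Fin 2) ℚ_[p] → Dk p}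
    (hΦ : Φ ∈ rigidEigen p k Γ) : specialization p k Φ ∈ padicEigen p k Γ := by
  obtain ⟨⟨h1, h2⟩, h3⟩ := hΦ
  refine ⟨⟨fun u γ hγ g => ?_, fun g σ hσ => ?_⟩, ?_⟩
  · exact congrArg (piMap p k) (h1 u γ hγ g)
  · exact (congrArg (piMap p k) (h2 g σ hσ)).trans (piMap_dkAct p hk _ _)
  · have h3 := (mem_eigenspace_Up_iff p k _ _).1 h3
    refine (mem_eigenspace_Up_iff p k _ _).2 (funext fun g => ?_)
    refine (piMap_UpNorm p hk Φ g).symm.trans ?_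
    rw [h3]
    rfl

lemma eq_zero_of_specialization_eq_zero (hk : Even k) (hΓ : FiniteDoubleCosets p Γ)
    {Φ : GL (Fin 2) ℚ_[p] → Dk p} (hΦ : Φ ∈ rigidEigen p k Γ)
    (h0 : specialization p k Φ = 0) : Φ = 0 := by
  obtain ⟨⟨h1, h2⟩, h3⟩ := hΦ
  have h3 := (mem_eigenspace_Up_iff p k _ _).1 h3
  obtain ⟨C, hC⟩ := exists_bound_of_finite hΓ (fun g => ‖Φ g‖)
    (fun u γ hγ g => by rw [h1 u γ hγ g])
    (fun g σ hσ => by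
      rw [h2 g σ hσ]
      exact norm_dkAct_gamma0_le p k hσ _)
  ext1 g
  refine norm_le_zero_iff.1 ?_
  refine le_zero_of_le_mul_self (F := fun g => ‖Φ g‖) (norm_nonneg (p : ℚ_[p]))
    Padic.norm_p_lt_one hC (fun C hC g => ?_) g
  have := norm_UpNorm_le p hk Φ (fun g => congrFun h0 g) hC g
  rwa [h3] at this

/-- A bounded solution of `U_p Φ = p^(k/2) Φ` whose specialization is equivariant is itself
equivariant. -/
lemma equivariant_of_bounded (hk : Even k) {Φ : GL (Fin 2) ℚ_[p] → Dk p}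
    (hU : UpNorm p (dkAct p k) Φ = Φ) {C : ℝ} (hC : ∀ g, ‖Φ g‖ ≤ C)
    (hσ : ∀ g : GL (Fin 2) ℚ_[p], ∀ σ ∈ gamma0 p,
      piMap p k (Φ (g * σ)) = vkAct p k σ (piMap p k (Φ g)))
    (g σ : GL (Fin 2) ℚ_[p]) (hσ' : σ ∈ gamma0 p) :
    Φ (g * σ) = dkAct p k ⟨σ, gamma0_subset p hσ'⟩ (Φ g) := by
  -- `E` is the defect of equivariance, indexed by all pairs `(g, σ)` at once because the recursion
  -- below changes `g` and `σ` together.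
  let E : GL (Fin 2) ℚ_[p] × gamma0 p → Dk p := fun x =>
    Φ (x.1 * x.2) - dkAct p k ⟨x.2, gamma0_subset p x.2.2⟩ (Φ x.1)
  have hEC : ∀ x, ‖E x‖ ≤ C + C := fun x =>
    (norm_sub_le _ _).trans (add_le_add (hC _) ((norm_dkAct_gamma0_le p k x.2.2 _).trans (hC _)))
  have hE0 : ∀ x, piMap p k (E x) = 0 := fun x => by
    rw [map_sub, piMap_dkAct p hk, hσ _ _ x.2.2, sub_self]
  -- From `U_p Φ = p^(k/2) Φ` and `σ α_j = α_(e j) τ_j`, the defect at `(g, σ)` is the sum over `j`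
  -- of the defects at `(g α_(e j), τ_j)`, each acted on by `α_j⁻¹`.
  have hrec : ∀ x, ∃ y : ℕ → GL (Fin 2) ℚ_[p] × gamma0 p,
      E x = ∑ j ∈ Finset.range p, dkAct p k ⟨(alpha p j)⁻¹, alpha_inv_mem p j⟩ (E (y j)) := by
    rintro ⟨g, σ, hσ⟩
    obtain ⟨e, τ, he, hτ, heq, hinj⟩ := exists_gamma0_mul_alpha p hσ
    refine ⟨fun j => (g * alpha p (e j), ⟨τ j, hτ j⟩), ?_⟩
    have h1 : Φ (g * σ) = ∑ j ∈ Finset.range p,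
        dkAct p k ⟨(alpha p j)⁻¹, alpha_inv_mem p j⟩ (Φ (g * alpha p (e j) * τ j)) := by
      conv_lhs => rw [← hU]
      refine Finset.sum_congr rfl fun j _ => ?_
      rw [mul_assoc, heq, mul_assoc]
    have h2 : dkAct p k ⟨σ, gamma0_subset p hσ⟩ (Φ g) = ∑ j ∈ Finset.range p,
        dkAct p k ⟨(alpha p j)⁻¹, alpha_inv_mem p j⟩
          (dkAct p k ⟨τ j, gamma0_subset p (hτ j)⟩ (Φ (g * alpha p (e j)))) := by
      conv_lhs => rw [← hU, UpNorm, map_sum]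
      -- The sum over `j` is reindexed by the permutation `e`, to match the cosets met in `Φ (g *
      -- σ)`.
      rw [← sum_range_comp_injOn he hinj fun j => dkAct p k ⟨σ, gamma0_subset p hσ⟩
        (dkAct p k ⟨(alpha p j)⁻¹, alpha_inv_mem p j⟩ (Φ (g * alpha p j)))]
      refine Finset.sum_congr rfl fun j _ => dkAct_dkAct_eq p k ?_ _
      change (alpha p (e j))⁻¹ * σ = τ j * (alpha p j)⁻¹
      rw [inv_mul_eq_iff_eq_mul, ← mul_assoc, ← heq, mul_inv_cancel_right]
    simp only [E]
    rw [h1, h2, ← Finset.sum_sub_distrib]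
    refine Finset.sum_congr rfl fun j _ => ?_
    rw [map_sub]
  refine sub_eq_zero.1 (norm_le_zero_iff.1 ?_)
  refine le_zero_of_le_mul_self (F := fun x => ‖E x‖) (norm_nonneg (p : ℚ_[p]))
    Padic.norm_p_lt_one hEC (fun C hC x => ?_) (g, ⟨σ, hσ'⟩)
  obtain ⟨y, hy⟩ := hrec x
  rw [hy]
  exact norm_sum_dkAct_alpha_inv_le p hk _ (fun j => E (y j)) (fun _ => hE0 _)
    ((norm_nonneg _).trans (hC x)) fun _ => hC _

/-- The iterates of `U_p`, starting from a bounded lift of an eigenform, converge uniformly. -/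
lemma exists_limit_of_iterates (hk : Even k) {φ : GL (Fin 2) ℚ_[p] → Vk p k}
    {Ψ : ℕ → GL (Fin 2) ℚ_[p] → Dk p} (hsucc : ∀ n, Ψ (n + 1) = UpNorm p (dkAct p k) (Ψ n))
    (hpi : ∀ n g, piMap p k (Ψ n g) = φ g) {C : ℝ} (hC : ∀ g, ‖Ψ 0 g‖ ≤ C) :
    ∃ Φ : GL (Fin 2) ℚ_[p] → Dk p,
      (∀ g, Filter.Tendsto (fun n => Ψ n g) Filter.atTop (𝓝 (Φ g))) ∧ ∃ C', ∀ g, ‖Φ g‖ ≤ C' := by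
  -- A crude bound by operator norms: `Ψ 0` is not killed by `piMap`, so the contraction applies
  -- only to differences.
  obtain ⟨B, hB⟩ : ∃ B, ∀ g, ‖Ψ 1 g‖ ≤ B :=
    ⟨∑ j ∈ Finset.range p, ‖tateAct p k ⟨(alpha p j)⁻¹, alpha_inv_mem p j⟩‖ * C, fun g => by
      rw [hsucc 0]
      exact (norm_sum_le _ _).trans (Finset.sum_le_sum fun j _ => (norm_dkAct_le p k _ _).trans
        (mul_le_mul_of_nonneg_left (hC _) (norm_nonneg _)))⟩
  have hr1 : ‖(p : ℚ_[p])‖ < 1 := Padic.norm_p_lt_one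
  -- Consecutive iterates have the same specialization, so their difference lies in the kernel of
  -- `piMap`, where each step gains `‖p‖`.
  have hstep : ∀ n g, ‖Ψ n g - Ψ (n + 1) g‖ ≤ (C + B) * ‖(p : ℚ_[p])‖ ^ n := fun n => by
    induction n with
    | zero =>
      intro g
      rw [pow_zero, mul_one]
      exact (norm_sub_le _ _).trans (add_le_add (hC g) (hB g))
    | succ n ih =>
      intro g
      have h5 : Ψ (n + 1) g - Ψ (n + 1 + 1) g =
          UpNorm p (dkAct p k) (fun g => Ψ n g - Ψ (n + 1) g) g := by
        rw [hsucc (n + 1)]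
        nth_rw 1 [hsucc n]
        simp only [UpNorm, map_sub, Finset.sum_sub_distrib]
      rw [h5, pow_succ']
      refine (norm_UpNorm_le p hk _ (fun g => ?_) ih g).trans_eq (by ring)
      rw [map_sub, hpi, hpi, sub_self]
  have hdist : ∀ g n, dist (Ψ n g) (Ψ (n + 1) g) ≤ (C + B) * ‖(p : ℚ_[p])‖ ^ n := fun g n => by
    rw [dist_eq_norm]
    exact hstep n g
  choose Φ hΦ using fun g =>
    cauchySeq_tendsto_of_complete (cauchySeq_of_le_geometric _ (C + B) hr1 (hdist g))
  refine ⟨Φ, hΦ, C + (C + B) / (1 - ‖(p : ℚ_[p])‖), fun g => ?_⟩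
  have h6 := dist_le_of_le_geometric_of_tendsto₀ _ (C + B) hr1 (hdist g) (hΦ g)
  rw [dist_eq_norm] at h6
  calc ‖Φ g‖ = ‖Ψ 0 g - (Ψ 0 g - Φ g)‖ := by rw [sub_sub_cancel]
    _ ≤ _ := (norm_sub_le _ _).trans (add_le_add (hC g) h6)

/-- The lift of `φ (g * σ)` is the truncation of the lift of `φ g` acted on by `σ`, so its norm is
at most that of the lift of `φ g`; finiteness of double cosets then gives a uniform bound. -/
lemma exists_bound_vkLift (hk : Even k) (hΓ : FiniteDoubleCosets p Γ)
    {φ : GL (Fin 2) ℚ_[p] → Vk p k} (hφ : φ ∈ padicForms p k Γ) :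
    ∃ C, ∀ g, ‖vkLift p k (φ g)‖ ≤ C := by
  obtain ⟨h1, h2⟩ := hφ
  refine exists_bound_of_finite hΓ (fun g => ‖vkLift p k (φ g)‖)
    (fun u γ hγ g => by rw [h1 u γ hγ g]) (fun g σ hσ => ?_)
  rw [h2 g σ hσ]
  have h4 := piMap_dkAct p hk ⟨σ, gamma0_subset p hσ⟩ (vkLift p k (φ g))
  rw [piMap_vkLift] at h4
  rw [← h4]
  exact (norm_vkLift_piMap_le p k _).trans (norm_dkAct_gamma0_le p k hσ _)

lemma UpNorm_eq_of_tendsto {Ψ : ℕ → GL (Fin 2) ℚ_[p] → Dk p} {Φ : GL (Fin 2) ℚ_[p] → Dk p}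
    (hsucc : ∀ n, Ψ (n + 1) = UpNorm p (dkAct p k) (Ψ n))
    (hΦ : ∀ g, Filter.Tendsto (fun n => Ψ n g) Filter.atTop (𝓝 (Φ g))) :
    UpNorm p (dkAct p k) Φ = Φ := by
  ext1 g
  refine tendsto_nhds_unique ?_ ((Filter.tendsto_add_atTop_iff_nat 1).2 (hΦ g))
  simp only [hsucc]
  exact tendsto_finsetSum _ fun j _ => ((continuous_dkAct p k _).tendsto _).comp (hΦ _)

lemma piMap_eq_of_tendsto {ψ : ℕ → Dk p} {ω : Dk p} {v : Vk p k}
    (hψ : Filter.Tendsto ψ Filter.atTop (𝓝 ω)) (h : ∀ n, piMap p k (ψ n) = v) :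
    piMap p k ω = v := by
  ext P
  have h7 : Filter.Tendsto (fun n => ψ n (polyToTate p k P)) Filter.atTop
      (𝓝 (ω (polyToTate p k P))) :=
    ((ContinuousLinearMap.apply ℚ_[p] ℚ_[p] (polyToTate p k P)).continuous.tendsto _).comp hψ
  refine tendsto_nhds_unique h7 (tendsto_const_nhds.congr fun n => ?_)
  rw [← piMap_apply, h]

/-- Left invariance and specialization hold for every iterate and pass to the limit. Iwahori
equivariance may fail for each iterate and is recovered only for the limit. -/
lemma exists_rigid_lift (hk : Even k) (hΓ : FiniteDoubleCosets p Γ)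
    {φ : GL (Fin 2) ℚ_[p] → Vk p k} (hφ : φ ∈ padicEigen p k Γ) :
    ∃ Φ ∈ rigidEigen p k Γ, specialization p k Φ = φ := by
  obtain ⟨C, hC⟩ := exists_bound_vkLift hk hΓ hφ.1
  obtain ⟨⟨h1, h2⟩, h3⟩ := hφ
  have h3 := (mem_eigenspace_Up_iff p k _ _).1 h3
  obtain ⟨Ψ, hzero, hsucc⟩ : ∃ Ψ : ℕ → GL (Fin 2) ℚ_[p] → Dk p,
      (∀ g, Ψ 0 g = vkLift p k (φ g)) ∧ ∀ n, Ψ (n + 1) = UpNorm p (dkAct p k) (Ψ n) :=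
    ⟨fun n => Nat.rec (fun g => vkLift p k (φ g)) (fun _ Φ => UpNorm p (dkAct p k) Φ) n,
      fun _ => rfl, fun _ => rfl⟩
  have hpi : ∀ n g, piMap p k (Ψ n g) = φ g := fun n => by
    induction n with
    | zero =>
      intro g
      rw [hzero, piMap_vkLift]
    | succ n ih =>
      intro g
      rw [hsucc]
      refine (piMap_UpNorm p hk _ g).trans ?_
      rw [funext ih, h3]
  have hinv : ∀ n, ∀ (u : ℚ_[p]ˣ), ∀ γ ∈ Γ, ∀ g,
      Ψ n (Matrix.GeneralLinearGroup.scalar (Fin 2) u * γ * g) = Ψ n g := fun n => by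
    induction n with
    | zero =>
      intro u γ hγ g
      rw [hzero, hzero, h1 u γ hγ]
    | succ n ih =>
      intro u γ hγ g
      rw [hsucc]
      refine Finset.sum_congr rfl fun j _ => ?_
      rw [mul_assoc _ g, ih u γ hγ]
  obtain ⟨Φ, hΦ, C', hbound⟩ := exists_limit_of_iterates hk hsucc hpi fun g => by
    rw [hzero]
    exact hC g
  have hU := UpNorm_eq_of_tendsto hsucc hΦ
  have hspec : ∀ g, piMap p k (Φ g) = φ g := fun g => piMap_eq_of_tendsto (hΦ g) fun n => hpi n g
  refine ⟨Φ, ⟨⟨fun u γ hγ g => ?_, fun g σ hσ => ?_⟩, (mem_eigenspace_Up_iff p k _ _).2 hU⟩,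
    funext hspec⟩
  · refine tendsto_nhds_unique (hΦ _) ((hΦ g).congr fun n => ?_)
    rw [hinv n u γ hγ]
  · refine equivariant_of_bounded hk hU hbound (fun g σ hσ => ?_) g σ hσ
    rw [hspec, hspec]
    exact h2 g σ hσ

theorem control_of_finite (hk : Even k) (hΓ : FiniteDoubleCosets p Γ) :
    ∃ e : rigidEigen p k Γ ≃ₗ[ℚ_[p]] padicEigen p k Γ, ∀ Φ : rigidEigen p k Γ,
      (e Φ : GL (Fin 2) ℚ_[p] → Vk p k) =
        specialization p k (Φ : GL (Fin 2) ℚ_[p] → Dk p) := by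
  let ρ : rigidEigen p k Γ →ₗ[ℚ_[p]] padicEigen p k Γ :=
    (specialization p k).restrict fun Φ hΦ => specialization_mem_padicEigen hk hΦ
  refine ⟨LinearEquiv.ofBijective ρ ⟨?_, ?_⟩, fun Φ => rfl⟩
  · rintro ⟨Φ, hΦ⟩ ⟨Φ', hΦ'⟩ h
    refine Subtype.ext (sub_eq_zero.1 (eq_zero_of_specialization_eq_zero hk hΓ
      (Submodule.sub_mem _ hΦ hΦ') ?_))
    rw [map_sub, sub_eq_zero]
    exact congrArg Subtype.val h
  · rintro ⟨φ, hφ⟩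
    obtain ⟨Φ, hΦ, h⟩ := exists_rigid_lift hk hΓ hφ
    exact ⟨⟨Φ, hΦ⟩, Subtype.ext h⟩

end control

/-! ### Reduced norms, units of `R[1/p]` and an explicit lattice inside `R`. -/

section quaternion

variable {a b : ℚ}

/-- The reduced norm of `x + yi + zj + wk`. -/
def reducedNorm (x : ℍ[ℚ,a,b]) : ℚ :=
  x.re ^ 2 - a * x.imI ^ 2 - b * x.imJ ^ 2 + a * b * x.imK ^ 2

lemma mul_star_eq_reducedNorm (x : ℍ[ℚ,a,b]) :
    x * star x = algebraMap ℚ ℍ[ℚ,a,b] (reducedNorm x) := by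
  ext <;> simp [reducedNorm, QuaternionAlgebra.algebraMap_eq] <;> ring

lemma reducedNorm_star (x : ℍ[ℚ,a,b]) : reducedNorm (star x) = reducedNorm x := by
  simp [reducedNorm]

lemma reducedNorm_mul (x y : ℍ[ℚ,a,b]) : reducedNorm (x * y) = reducedNorm x * reducedNorm y := by
  simp [reducedNorm]
  ring

lemma reducedNorm_smul (q : ℚ) (x : ℍ[ℚ,a,b]) : reducedNorm (q • x) = q ^ 2 * reducedNorm x := by
  simp [reducedNorm]
  ring

lemma star_mul_eq_reducedNorm (x : ℍ[ℚ,a,b]) :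
    star x * x = algebraMap ℚ ℍ[ℚ,a,b] (reducedNorm x) := by
  rw [← reducedNorm_star x, ← mul_star_eq_reducedNorm, star_star]

lemma reducedNorm_pos (ha : a < 0) (hb : b < 0) {x : ℍ[ℚ,a,b]} (hx : x ≠ 0) :
    0 < reducedNorm x := by
  have hab : 0 < a * b := mul_pos_of_neg_of_neg ha hb
  have h1 := sq_nonneg x.re
  have h2 : 0 ≤ -a * x.imI ^ 2 := mul_nonneg (by linarith) (sq_nonneg _)
  have h3 : 0 ≤ -b * x.imJ ^ 2 := mul_nonneg (by linarith) (sq_nonneg _)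
  have h4 : 0 ≤ a * b * x.imK ^ 2 := mul_nonneg hab.le (sq_nonneg _)
  refine lt_of_le_of_ne (by unfold reducedNorm; linarith) fun h => hx ?_
  unfold reducedNorm at h
  have e1 : x.re ^ 2 = 0 := by linarith
  have e2 : -a * x.imI ^ 2 = 0 := by linarith
  have e3 : -b * x.imJ ^ 2 = 0 := by linarith
  have e4 : a * b * x.imK ^ 2 = 0 := by linarith
  ext
  · simpa using e1
  · simpa [ha.ne] using e2
  · simpa [hb.ne] using e3
  · simpa [ha.ne, hb.ne] using e4

lemma algebraMap_mul_comm (q : ℚ) (x : ℍ[ℚ,a,b]) :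
    x * algebraMap ℚ ℍ[ℚ,a,b] q = algebraMap ℚ ℍ[ℚ,a,b] q * x :=
  (Algebra.commutes q x).symm

/-- A quaternion of nonzero reduced norm, as a unit. -/
def quatUnit (x : ℍ[ℚ,a,b]) (hx : reducedNorm x ≠ 0) : (ℍ[ℚ,a,b])ˣ where
  val := x
  inv := algebraMap ℚ ℍ[ℚ,a,b] (reducedNorm x)⁻¹ * star x
  val_inv := by
    rw [← mul_assoc, algebraMap_mul_comm, mul_assoc, mul_star_eq_reducedNorm, ← map_mul,
      inv_mul_cancel₀ hx, map_one]
  inv_val := by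
    rw [mul_assoc, star_mul_eq_reducedNorm, ← map_mul, inv_mul_cancel₀ hx, map_one]

/-- Here `x y⁻¹ = 1 + N r · star y / nrd(y)`, and `N / nrd(y) = D / p^s` by `hD`; multiplication by
`p^s` therefore lands in `R`. -/
lemma quatUnit_mul_inv_mem_awayFrom {R : Subring ℍ[ℚ,a,b]} {p : ℕ} (hp : p ≠ 0)
    {x y r : ℍ[ℚ,a,b]} (hx : reducedNorm x ≠ 0) (hy : reducedNorm y ≠ 0) (hyR : star y ∈ R)
    {D N s : ℕ} (hN : N ≠ 0) (hD : (D : ℚ) * reducedNorm y = p ^ s * N) (hr : r ∈ R)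
    (hxy : x - y = (N : ℍ[ℚ,a,b]) * r) :
    ((quatUnit x hx * (quatUnit y hy)⁻¹ : (ℍ[ℚ,a,b])ˣ) : ℍ[ℚ,a,b]) ∈ awayFrom R p := by
  refine ⟨s, ?_⟩
  have hD' : (p : ℚ) ^ s * (reducedNorm y)⁻¹ * N = D := by
    have : (p : ℚ) ^ s ≠ 0 := pow_ne_zero _ (by exact_mod_cast hp)
    have hN' : (N : ℚ) ≠ 0 := by exact_mod_cast hN
    field_simp
    linarith
  have hinv : (((quatUnit y hy)⁻¹ : (ℍ[ℚ,a,b])ˣ) : ℍ[ℚ,a,b]) =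
    algebraMap ℚ ℍ[ℚ,a,b] (reducedNorm y)⁻¹ * star y := rfl
  have h1 : ((quatUnit x hx * (quatUnit y hy)⁻¹ : (ℍ[ℚ,a,b])ˣ) : ℍ[ℚ,a,b]) =
      1 + (N : ℍ[ℚ,a,b]) * r * (algebraMap ℚ ℍ[ℚ,a,b] (reducedNorm y)⁻¹ * star y) := by
    rw [Units.val_mul, ← hinv, ← hxy, sub_mul]
    change x * _ = 1 + (x * _ - ((quatUnit y hy : (ℍ[ℚ,a,b])ˣ) : ℍ[ℚ,a,b]) * _)
    rw [Units.mul_inv]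
    abel
  have hp' : ((p : ℍ[ℚ,a,b]) ^ s) = algebraMap ℚ ℍ[ℚ,a,b] ((p : ℚ) ^ s) := by
    rw [map_pow, map_natCast]
  have hNq : (N : ℍ[ℚ,a,b]) = algebraMap ℚ ℍ[ℚ,a,b] (N : ℚ) := by simp
  have h2 : (p : ℍ[ℚ,a,b]) ^ s * ((quatUnit x hx * (quatUnit y hy)⁻¹ : (ℍ[ℚ,a,b])ˣ) : ℍ[ℚ,a,b]) =
      (p : ℍ[ℚ,a,b]) ^ s + (D : ℍ[ℚ,a,b]) * (r * star y) := by
    have hDq : (D : ℍ[ℚ,a,b]) = algebraMap ℚ ℍ[ℚ,a,b] (D : ℚ) := by simp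
    rw [h1, mul_add, mul_one, hp', hNq, hDq, ← hD', mul_assoc, ← mul_assoc r, algebraMap_mul_comm,
      map_mul, map_mul]
    congr 1
    rw [mul_assoc (algebraMap ℚ ℍ[ℚ,a,b] (reducedNorm y)⁻¹) r, ← mul_assoc (algebraMap _ _ (N : ℚ)),
      ← algebraMap_mul_comm (N : ℚ)]
    simp only [mul_assoc]
  rw [h2]
  exact R.add_mem (R.pow_mem (natCast_mem R p) s)
    (R.mul_mem (natCast_mem R D) (R.mul_mem hr hyR))

/-- Two quaternions of the same reduced norm `ν` that are congruent modulo `N`, where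
`D ν = p^s N`, differ by a unit of `R[1/p]` of reduced norm one. -/
lemma quatUnit_mul_inv_mem_normOneUnits {R : Subring ℍ[ℚ,a,b]} {p : ℕ} (hp : p ≠ 0)
    {x y r : ℍ[ℚ,a,b]} (hx : reducedNorm x ≠ 0) (hy : reducedNorm y ≠ 0)
    (hxR : star x ∈ R) (hyR : star y ∈ R) (hxy' : reducedNorm x = reducedNorm y)
    {D N s : ℕ} (hN : N ≠ 0) (hD : (D : ℚ) * reducedNorm y = p ^ s * N) (hr : r ∈ R)
    (hxy : x - y = (N : ℍ[ℚ,a,b]) * r) :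
    quatUnit x hx * (quatUnit y hy)⁻¹ ∈ normOneUnits R p := by
  refine ⟨quatUnit_mul_inv_mem_awayFrom hp hx hy hyR hN hD hr hxy, ?_, ?_⟩
  · rw [mul_inv_rev, inv_inv]
    refine quatUnit_mul_inv_mem_awayFrom hp hy hx hxR hN (hxy' ▸ hD) (R.neg_mem hr) ?_
    rw [mul_neg, ← hxy, neg_sub]
  · have hinv : (((quatUnit y hy)⁻¹ : (ℍ[ℚ,a,b])ˣ) : ℍ[ℚ,a,b]) =
      algebraMap ℚ ℍ[ℚ,a,b] (reducedNorm y)⁻¹ * star y := rfl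
    have hxe : ((quatUnit x hx : (ℍ[ℚ,a,b])ˣ) : ℍ[ℚ,a,b]) = x := rfl
    have h1 : ((quatUnit x hx * (quatUnit y hy)⁻¹ : (ℍ[ℚ,a,b])ˣ) : ℍ[ℚ,a,b]) =
        (reducedNorm y)⁻¹ • (x * star y) := by
      rw [Units.val_mul, hinv, hxe, ← mul_assoc, algebraMap_mul_comm, mul_assoc, Algebra.smul_def]
    rw [h1, mul_star_eq_reducedNorm, ← map_one (algebraMap ℚ ℍ[ℚ,a,b])]
    congr 1
    have h2 : reducedNorm ((reducedNorm y)⁻¹ • (x * star y)) =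
        (reducedNorm y)⁻¹ ^ 2 * (reducedNorm x * reducedNorm y) := by
      rw [reducedNorm_smul, reducedNorm_mul, reducedNorm_star]
    rw [h2, hxy']
    field_simp

/-- The element `n(c₀ + c₁i + c₂j + c₃k)`. -/
def latticeElt (n : ℕ) (c : Fin 4 → ℤ) : ℍ[ℚ,a,b] := ⟨n * c 0, n * c 1, n * c 2, n * c 3⟩

lemma latticeElt_eq_sum (n : ℕ) (c : Fin 4 → ℤ) :
    (latticeElt n c : ℍ[ℚ,a,b]) = ∑ t, c t • latticeElt n (Pi.single t 1) := by
  rw [Fin.sum_univ_four]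
  ext <;> simp [latticeElt] <;> ring

lemma latticeElt_mem {R : Subring ℍ[ℚ,a,b]} {n : ℕ}
    (h : ∀ t, (latticeElt n (Pi.single t 1) : ℍ[ℚ,a,b]) ∈ R) (c : Fin 4 → ℤ) :
    (latticeElt n c : ℍ[ℚ,a,b]) ∈ R := by
  rw [latticeElt_eq_sum]
  exact R.sum_mem fun t _ => R.zsmul_mem (h t) _

/-- Conjugation only changes signs of coordinates, so the lattice is stable under it; stability of
`R` itself is not needed. -/
lemma star_latticeElt_mem {R : Subring ℍ[ℚ,a,b]} {n : ℕ}
    (h : ∀ t, (latticeElt n (Pi.single t 1) : ℍ[ℚ,a,b]) ∈ R) (c : Fin 4 → ℤ) :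
    star (latticeElt n c : ℍ[ℚ,a,b]) ∈ R := by
  have : star (latticeElt n c : ℍ[ℚ,a,b]) = latticeElt n ![c 0, -c 1, -c 2, -c 3] := by
    ext <;> simp [latticeElt]
  rw [this]
  exact latticeElt_mem h _

lemma exists_natCast_mul_mem {R : Subring ℍ[ℚ,a,b]}
    (hR : Submodule.span ℚ (R : Set ℍ[ℚ,a,b]) = ⊤) (x : ℍ[ℚ,a,b]) :
    ∃ n : ℕ, n ≠ 0 ∧ (n : ℍ[ℚ,a,b]) * x ∈ R := by
  have hx : x ∈ Submodule.span ℚ (R : Set ℍ[ℚ,a,b]) := hR ▸ Submodule.mem_top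
  induction hx using Submodule.span_induction with
  | mem x hx => exact ⟨1, one_ne_zero, by simpa using hx⟩
  | zero => exact ⟨1, one_ne_zero, by simp⟩
  | add x y _ _ hx hy =>
    obtain ⟨m, hm, hm'⟩ := hx
    obtain ⟨n, hn, hn'⟩ := hy
    refine ⟨m * n, mul_ne_zero hm hn, ?_⟩
    have h : ((m * n : ℕ) : ℍ[ℚ,a,b]) * (x + y) = n * (m * x) + m * (n * y) := by
      rw [mul_add, ← mul_assoc, ← mul_assoc, ← Nat.cast_mul, ← Nat.cast_mul, mul_comm n m]
    rw [h]
    exact R.add_mem (R.mul_mem (natCast_mem R n) hm') (R.mul_mem (natCast_mem R m) hn')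
  | smul q x _ hx =>
    obtain ⟨m, hm, hm'⟩ := hx
    refine ⟨q.den * m, mul_ne_zero q.den_nz hm, ?_⟩
    have h : ((q.den * m : ℕ) : ℍ[ℚ,a,b]) * (q • x) = (q.num : ℍ[ℚ,a,b]) * (m * x) := by
      have e1 : ((q.den * m : ℕ) : ℍ[ℚ,a,b]) = algebraMap ℚ ℍ[ℚ,a,b] (q.den * m) := by
        rw [map_mul, map_natCast, map_natCast, Nat.cast_mul]
      have e2 : (q.num : ℍ[ℚ,a,b]) = algebraMap ℚ ℍ[ℚ,a,b] q.num := by simp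
      have e3 : (m : ℍ[ℚ,a,b]) = algebraMap ℚ ℍ[ℚ,a,b] m := by simp
      rw [e1, e2, e3, Algebra.smul_def, ← mul_assoc, ← mul_assoc, ← map_mul, ← map_mul]
      congr 2
      rw [mul_right_comm, Rat.den_mul_eq_num]
    rw [h]
    exact R.mul_mem (intCast_mem R _) hm'

/-- Each of the two maximal orders spans over `ℚ`, so denominators of `1, i, j, k` can be cleared
for both at once; `n` is the product over the four basis elements. -/
lemma exists_latticeElt_mem {R : Subring ℍ[ℚ,a,b]} {N : ℕ} (hR : IsEichlerOrder R N) :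
    ∃ n : ℕ, n ≠ 0 ∧ ∀ t, (latticeElt n (Pi.single t 1) : ℍ[ℚ,a,b]) ∈ R := by
  obtain ⟨O₁, O₂, ⟨⟨-, h₁⟩, -⟩, ⟨⟨-, h₂⟩, -⟩, rfl, -, -⟩ := hR
  have h : ∀ x : ℍ[ℚ,a,b], ∃ n : ℕ, n ≠ 0 ∧ (n : ℍ[ℚ,a,b]) * x ∈ O₁ ⊓ O₂ := fun x => by
    obtain ⟨m, hm, hm'⟩ := exists_natCast_mul_mem h₁ x
    obtain ⟨n, hn, hn'⟩ := exists_natCast_mul_mem h₂ x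
    refine ⟨m * n, mul_ne_zero hm hn, ?_, ?_⟩
    · rw [mul_comm, Nat.cast_mul, mul_assoc]
      exact O₁.mul_mem (natCast_mem O₁ n) hm'
    · rw [Nat.cast_mul, mul_assoc]
      exact O₂.mul_mem (natCast_mem O₂ m) hn'
  choose n hn hn' using fun t : Fin 4 => h (latticeElt 1 (Pi.single t 1))
  refine ⟨∏ t, n t, Finset.prod_ne_zero_iff.2 fun t _ => hn t, fun t => ?_⟩
  obtain ⟨q, hq⟩ := Finset.dvd_prod_of_mem n (Finset.mem_univ t)
  have : (latticeElt (∏ t, n t) (Pi.single t 1) : ℍ[ℚ,a,b]) =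
      (q : ℍ[ℚ,a,b]) * ((n t : ℍ[ℚ,a,b]) * latticeElt 1 (Pi.single t 1)) := by
    rw [hq]
    ext <;> simp [latticeElt] <;> ring
  rw [this]
  exact (O₁ ⊓ O₂).mul_mem (natCast_mem _ q) (hn' t)

end quaternion

/-! ### Trace and determinant under a `p`-adic splitting. -/

section splitting

variable {p : ℕ} [Fact p.Prime] {a b : ℚ}

/-- The embedding of the quaternion algebra in `M₂(ℚ_p)` given by a splitting. -/
def quatToMatrix (ι : (ℚ_[p] ⊗[ℚ] ℍ[ℚ,a,b]) ≃ₐ[ℚ_[p]] Matrix (Fin 2) (Fin 2) ℚ_[p]) :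
    ℍ[ℚ,a,b] →+* Matrix (Fin 2) (Fin 2) ℚ_[p] :=
  ι.toRingEquiv.toRingHom.comp (Algebra.TensorProduct.includeRight :
    ℍ[ℚ,a,b] →ₐ[ℚ] ℚ_[p] ⊗[ℚ] ℍ[ℚ,a,b]).toRingHom

variable (ι : (ℚ_[p] ⊗[ℚ] ℍ[ℚ,a,b]) ≃ₐ[ℚ_[p]] Matrix (Fin 2) (Fin 2) ℚ_[p])

lemma quatToMatrix_algebraMap (q : ℚ) :
    quatToMatrix ι (algebraMap ℚ ℍ[ℚ,a,b] q) = (q : ℚ_[p]) • 1 := by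
  change ι ((Algebra.TensorProduct.includeRight : ℍ[ℚ,a,b] →ₐ[ℚ] ℚ_[p] ⊗[ℚ] ℍ[ℚ,a,b])
    (algebraMap ℚ ℍ[ℚ,a,b] q)) = _
  rw [AlgHom.commutes, IsScalarTower.algebraMap_apply ℚ ℚ_[p] (ℚ_[p] ⊗[ℚ] ℍ[ℚ,a,b]),
    AlgEquiv.commutes, Algebra.algebraMap_eq_smul_one]
  rfl

/-- The trace of `A B B` is `s · tr A` directly, and `-s · tr A` after cyclic rotation and
anticommutation. -/
lemma trace_eq_zero_of_anticommute {A B : Matrix (Fin 2) (Fin 2) ℚ_[p]} {s : ℚ_[p]} (hs : s ≠ 0)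
    (hB : B * B = s • 1) (hAB : A * B = -(B * A)) : A.trace = 0 := by
  have h1 : (A * B * B).trace = s * A.trace := by
    rw [mul_assoc, hB, mul_smul_comm, mul_one, Matrix.trace_smul, smul_eq_mul]
  have h2 : (A * B * B).trace = -(s * A.trace) := by
    rw [Matrix.trace_mul_comm, hAB, mul_neg, Matrix.trace_neg, ← mul_assoc, hB, smul_mul_assoc,
      one_mul, Matrix.trace_smul, smul_eq_mul]
  have h3 : s * A.trace = 0 := by
    have := h1.symm.trans h2
    linear_combination this / 2
  exact (mul_eq_zero.1 h3).resolve_left hs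

/-- Each of `i, j, k` anticommutes with `i` or `j`, whose square is a nonzero scalar, so only the
real part contributes. -/
lemma trace_quatToMatrix (ha : a ≠ 0) (hb : b ≠ 0) (x : ℍ[ℚ,a,b]) :
    (quatToMatrix ι x).trace = 2 * (x.re : ℚ_[p]) := by
  have hsq : ∀ (y : ℍ[ℚ,a,b]) (q : ℚ), y * y = algebraMap ℚ ℍ[ℚ,a,b] q →
      quatToMatrix ι y * quatToMatrix ι y = (q : ℚ_[p]) • 1 := fun y q h => by
    rw [← map_mul, h, quatToMatrix_algebraMap]
  have hac : ∀ y z : ℍ[ℚ,a,b], y * z = -(z * y) → quatToMatrix ι y * quatToMatrix ι z =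
      -(quatToMatrix ι z * quatToMatrix ι y) := fun y z h => by
    rw [← map_mul, h, map_neg, map_mul]
  have ha' : (a : ℚ_[p]) ≠ 0 := by exact_mod_cast ha
  have hb' : (b : ℚ_[p]) ≠ 0 := by exact_mod_cast hb
  have hi : (⟨0, 1, 0, 0⟩ : ℍ[ℚ,a,b]) * ⟨0, 1, 0, 0⟩ = algebraMap ℚ ℍ[ℚ,a,b] a := by
    ext <;> simp [QuaternionAlgebra.algebraMap_eq]
  have hj : (⟨0, 0, 1, 0⟩ : ℍ[ℚ,a,b]) * ⟨0, 0, 1, 0⟩ = algebraMap ℚ ℍ[ℚ,a,b] b := by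
    ext <;> simp [QuaternionAlgebra.algebraMap_eq]
  have tI := trace_eq_zero_of_anticommute hb' (hsq _ _ hj)
    (hac ⟨0, 1, 0, 0⟩ ⟨0, 0, 1, 0⟩ (by ext <;> simp))
  have tJ := trace_eq_zero_of_anticommute ha' (hsq _ _ hi)
    (hac ⟨0, 0, 1, 0⟩ ⟨0, 1, 0, 0⟩ (by ext <;> simp))
  have tK := trace_eq_zero_of_anticommute ha' (hsq _ _ hi)
    (hac ⟨0, 0, 0, 1⟩ ⟨0, 1, 0, 0⟩ (by ext <;> simp))
  have hx : x = algebraMap ℚ ℍ[ℚ,a,b] x.re + algebraMap ℚ ℍ[ℚ,a,b] x.imI * ⟨0, 1, 0, 0⟩ +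
      algebraMap ℚ ℍ[ℚ,a,b] x.imJ * ⟨0, 0, 1, 0⟩ +
      algebraMap ℚ ℍ[ℚ,a,b] x.imK * ⟨0, 0, 0, 1⟩ := by
    ext <;> simp [QuaternionAlgebra.algebraMap_eq]
  conv_lhs => rw [hx]
  simp only [map_add, map_mul, quatToMatrix_algebraMap, smul_mul_assoc, one_mul, Matrix.trace_add,
    Matrix.trace_smul, tI, tJ, tK, Matrix.trace_one, smul_eq_mul]
  simp [mul_comm]

/-- By the trace formula `star x = 2 re(x) - x` goes to the adjugate, so `x * star x` goes to the
scalar matrix of the determinant. -/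
lemma det_quatToMatrix (ha : a ≠ 0) (hb : b ≠ 0) (x : ℍ[ℚ,a,b]) :
    (quatToMatrix ι x).det = (reducedNorm x : ℚ_[p]) := by
  have hstar : star x = algebraMap ℚ ℍ[ℚ,a,b] (2 * x.re) - x := by
    ext <;> simp [QuaternionAlgebra.algebraMap_eq]
    ring
  have h1 : quatToMatrix ι (star x) = (quatToMatrix ι x).adjugate := by
    rw [hstar, map_sub, quatToMatrix_algebraMap]
    have := trace_quatToMatrix ι ha hb x
    rw [Matrix.trace_fin_two] at this
    push_cast
    rw [← this, Matrix.adjugate_fin_two]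
    ext i j
    fin_cases i <;> fin_cases j <;> simp
  have h2 : quatToMatrix ι x * quatToMatrix ι (star x) = (reducedNorm x : ℚ_[p]) • 1 := by
    rw [← map_mul, mul_star_eq_reducedNorm, quatToMatrix_algebraMap]
  rw [h1, Matrix.mul_adjugate] at h2
  have h3 := congrFun (congrFun h2 0) 0
  simpa using h3

lemma norm_quatToMatrix_le {R : Subring ℍ[ℚ,a,b]} (hι : IsIntegralSplitting p R ι)
    {x : ℍ[ℚ,a,b]} (hx : x ∈ R) (i j : Fin 2) : ‖quatToMatrix ι x i j‖ ≤ 1 := by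
  have h : quatToMatrix ι x ∈ {M : Matrix (Fin 2) (Fin 2) ℚ_[p] | ∀ i j, ‖M i j‖ ≤ 1} := by
    rw [← hι]
    exact ⟨(1 : ℚ_[p]) ⊗ₜ[ℚ] x, Submodule.subset_span ⟨x, hx, rfl⟩, rfl⟩
  exact h i j

end splitting

/-! ### Primitive matrices over `ℤ_p`, the pigeonhole argument and congruent matrices. -/

section geometry

variable {p : ℕ} [Fact p.Prime]

/-- For a primitive matrix `G`, membership of a vector in the image of `G` is a single congruence
modulo `det G`. -/
lemma exists_functional (G : Matrix (Fin 2) (Fin 2) ℤ_[p]) (hG : ∃ i j, IsUnit (G i j)) :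
    ∃ r s : ℤ_[p], ∀ y z : ℤ_[p], G.det ∣ r * y + s * z →
      G.det ∣ G 1 1 * y - G 0 1 * z ∧ G.det ∣ G 0 0 * z - G 1 0 * y := by
  rw [Matrix.det_fin_two]
  obtain ⟨i, j, h⟩ := hG
  have htop : IsUnit (G 1 1) ∨ IsUnit (G 0 1) ∨ IsUnit (G 0 0) ∨ IsUnit (G 1 0) := by
    fin_cases i <;> fin_cases j <;> simp_all
  have key : ∀ u w : ℤ_[p], IsUnit u → G 0 0 * G 1 1 - G 0 1 * G 1 0 ∣ u * w →
      G 0 0 * G 1 1 - G 0 1 * G 1 0 ∣ w := fun u w hu h => (IsUnit.dvd_mul_left hu).1 h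
  -- A vector lies in the image of `G` when both rows of the adjugate kill it modulo `det G`. These
  -- rows are proportional modulo `det G`, so the row containing a unit controls the other.
  rcases htop with h | h | h | h
  · refine ⟨G 1 1, -G 0 1, fun y z hd => ?_⟩
    have hd' : G 0 0 * G 1 1 - G 0 1 * G 1 0 ∣ G 1 1 * y - G 0 1 * z := by
      convert hd using 1
      ring
    refine ⟨hd', key _ _ h ?_⟩
    have := dvd_sub (Dvd.intro z rfl : _ ∣ (G 0 0 * G 1 1 - G 0 1 * G 1 0) * z)
      (hd'.mul_left (G 1 0))
    convert this using 1
    ring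
  · refine ⟨G 1 1, -G 0 1, fun y z hd => ?_⟩
    have hd' : G 0 0 * G 1 1 - G 0 1 * G 1 0 ∣ G 1 1 * y - G 0 1 * z := by
      convert hd using 1
      ring
    refine ⟨hd', key _ _ h ?_⟩
    have := dvd_sub (Dvd.intro y rfl : _ ∣ (G 0 0 * G 1 1 - G 0 1 * G 1 0) * y)
      (hd'.mul_left (G 0 0))
    convert this using 1
    ring
  · refine ⟨-G 1 0, G 0 0, fun y z hd => ?_⟩
    have hd' : G 0 0 * G 1 1 - G 0 1 * G 1 0 ∣ G 0 0 * z - G 1 0 * y := by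
      convert hd using 1
      ring
    refine ⟨key _ _ h ?_, hd'⟩
    have := dvd_sub (Dvd.intro y rfl : _ ∣ (G 0 0 * G 1 1 - G 0 1 * G 1 0) * y)
      (hd'.mul_left (G 0 1))
    convert this using 1
    ring
  · refine ⟨-G 1 0, G 0 0, fun y z hd => ?_⟩
    have hd' : G 0 0 * G 1 1 - G 0 1 * G 1 0 ∣ G 0 0 * z - G 1 0 * y := by
      convert hd using 1
      ring
    refine ⟨key _ _ h ?_, hd'⟩
    have := dvd_sub (Dvd.intro z rfl : _ ∣ (G 0 0 * G 1 1 - G 0 1 * G 1 0) * z)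
      (hd'.mul_left (G 1 1))
    convert this using 1
    ring

/-- A pigeonhole argument: every primitive matrix `G` of determinant `p^v` (up to a unit) is a left
divisor of a small nonzero integral combination of four given matrices. -/
lemma exists_small_combination (E : Fin 4 → Matrix (Fin 2) (Fin 2) ℤ_[p])
    (G : Matrix (Fin 2) (Fin 2) ℤ_[p]) (hG : ∃ i j, IsUnit (G i j)) (v : ℕ)
    (hv : G.det ∣ (p : ℤ_[p]) ^ v) (hdet : G.det ≠ 0) :
    ∃ c : Fin 4 → ℤ, c ≠ 0 ∧ (∀ t, c t ^ 2 ≤ (p : ℤ) ^ v) ∧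
      ∃ m : Matrix (Fin 2) (Fin 2) ℤ_[p], ∑ t, (c t : ℤ_[p]) • E t = G * m := by
  obtain ⟨r, s, hrs⟩ := exists_functional G hG
  have hp : 0 < p := (Fact.out : p.Prime).pos
  have : NeZero (p ^ v) := ⟨(pow_pos hp v).ne'⟩
  set M := Nat.sqrt (p ^ v) with hM
  let L : Fin 2 → Matrix (Fin 2) (Fin 2) ℤ_[p] →+ ℤ_[p] := fun l =>
    { toFun := fun Y => r * Y 0 l + s * Y 1 l
      map_zero' := by simp
      map_add' := fun Y Z => by simp only [Matrix.add_apply]; ring }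
  let Y : (Fin 4 → ℤ) → Matrix (Fin 2) (Fin 2) ℤ_[p] := fun c => ∑ t, (c t : ℤ_[p]) • E t
  let f : (Fin 4 → Fin (M + 1)) → Fin 2 → ZMod (p ^ v) := fun c l =>
    PadicInt.toZModPow v (L l (Y fun t => ((c t : ℕ) : ℤ)))
  -- There is one congruence modulo `p^v` per column, hence `p^(2v)` classes, against `(M+1)^4`
  -- points of the box; and `(M+1)² > p^v` as `M` is the integer square root.
  have hcard : Fintype.card (Fin 2 → ZMod (p ^ v)) < Fintype.card (Fin 4 → Fin (M + 1)) := by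
    rw [Fintype.card_fun, Fintype.card_fun, ZMod.card, Fintype.card_fin, Fintype.card_fin,
      Fintype.card_fin, show (M + 1) ^ 4 = ((M + 1) * (M + 1)) ^ 2 by ring]
    exact Nat.pow_lt_pow_left (Nat.lt_succ_sqrt _) (by norm_num)
  obtain ⟨c, d, hne, hcd⟩ := Fintype.exists_ne_map_eq_of_card_lt f hcard
  have hY : Y (fun t => ((c t : ℕ) : ℤ) - ((d t : ℕ) : ℤ)) =
      Y (fun t => ((c t : ℕ) : ℤ)) - Y (fun t => ((d t : ℕ) : ℤ)) := by
    simp only [Y, ← Finset.sum_sub_distrib, ← sub_smul, Int.cast_sub]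
  refine ⟨fun t => ((c t : ℕ) : ℤ) - ((d t : ℕ) : ℤ), fun h => hne (funext fun t => ?_),
    fun t => ?_, ?_⟩
  · have := congrFun h t
    simp only [Pi.zero_apply] at this
    exact Fin.ext (by omega)
  · have h1 : (M : ℤ) ^ 2 ≤ (p : ℤ) ^ v := by
      exact_mod_cast Nat.sqrt_le' (p ^ v)
    have hc := (c t).2
    have hd := (d t).2
    refine le_trans (sq_le_sq' (a := ((c t : ℕ) : ℤ) - ((d t : ℕ) : ℤ)) ?_ ?_) h1 <;> omega
  · set W := Y (fun t => ((c t : ℕ) : ℤ) - ((d t : ℕ) : ℤ)) with hW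
    have hdvd : ∀ l, G.det ∣ r * W 0 l + s * W 1 l := fun l => by
      refine hv.trans ?_
      rw [← Ideal.mem_span_singleton, ← PadicInt.ker_toZModPow, RingHom.mem_ker]
      have h2 : r * W 0 l + s * W 1 l = L l W := rfl
      rw [h2, hY, map_sub, map_sub, sub_eq_zero]
      exact congrFun hcd l
    choose m₀ hm₀ using fun l => (hrs _ _ (hdvd l)).1
    choose m₁ hm₁ using fun l => (hrs _ _ (hdvd l)).2
    -- The rows `m₀`, `m₁` are those of `adj(G) W / det G`.
    refine ⟨Matrix.of ![m₀, m₁], ?_⟩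
    change W = _
    ext i l
    refine mul_left_cancel₀ hdet ?_
    rw [Matrix.mul_apply, Fin.sum_univ_two]
    simp only [Matrix.of_apply, Matrix.cons_val_zero, Matrix.cons_val_one]
    have e0 := hm₀ l
    have e1 := hm₁ l
    rw [mul_add, mul_left_comm, mul_left_comm _ (G i 1), ← e0, ← e1, Matrix.det_fin_two]
    fin_cases i
    · simp only [Fin.zero_eta]
      ring
    · simp only [Fin.mk_one]
      ring

/-- Every element of `GL₂(ℚ_p)` is, up to a scalar, a primitive integral matrix. -/
lemma exists_primitive (g : GL (Fin 2) ℚ_[p]) :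
    ∃ (u : ℚ_[p]ˣ) (G : Matrix (Fin 2) (Fin 2) ℤ_[p]), (∃ i j, IsUnit (G i j)) ∧ G.det ≠ 0 ∧
      G.map (PadicInt.Coe.ringHom (p := p)) =
        (u : ℚ_[p]) • (g : Matrix (Fin 2) (Fin 2) ℚ_[p]) := by
  obtain ⟨⟨i₀, j₀⟩, -, hmax⟩ := Finset.exists_max_image (Finset.univ : Finset (Fin 2 × Fin 2))
    (fun x => ‖g x.1 x.2‖) Finset.univ_nonempty
  have hmax : ∀ i j, ‖g i j‖ ≤ ‖g i₀ j₀‖ := fun i j => hmax (i, j) (Finset.mem_univ _)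
  have hne : g i₀ j₀ ≠ 0 := fun h => by
    have h0 : (g : Matrix (Fin 2) (Fin 2) ℚ_[p]) = 0 := by
      ext i j
      have := hmax i j
      rw [h, norm_zero, norm_le_zero_iff] at this
      exact this
    have := g.det_ne_zero
    rw [h0] at this
    simp at this
  let G : Matrix (Fin 2) (Fin 2) ℤ_[p] := fun i j => ⟨(g i₀ j₀)⁻¹ * g i j, by
      rw [norm_mul, norm_inv, inv_mul_le_iff₀ (norm_pos_iff.2 hne), mul_one]
      exact hmax i j⟩
  have hmap : G.map (PadicInt.Coe.ringHom (p := p)) =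
      (g i₀ j₀)⁻¹ • (g : Matrix (Fin 2) (Fin 2) ℚ_[p]) := by
    ext i j
    rfl
  refine ⟨(Units.mk0 _ hne)⁻¹, G, ⟨i₀, j₀, ?_⟩, fun h => ?_, ?_⟩
  · rw [PadicInt.isUnit_iff]
    change ‖(g i₀ j₀)⁻¹ * g i₀ j₀‖ = 1
    rw [inv_mul_cancel₀ hne, norm_one]
  · have h1 := congrArg Matrix.det hmap
    rw [← RingHom.mapMatrix_apply, ← RingHom.map_det, h, map_zero, Matrix.det_smul] at h1
    exact mul_ne_zero (pow_ne_zero _ (inv_ne_zero hne)) g.det_ne_zero h1.symm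
  · rw [Units.val_inv_eq_inv_val, Units.val_mk0]
    exact hmap

/-- The exponent `e` of `p` in `N` satisfies `e < p^e ≤ N ≤ K`, and the prime-to-`p` part of `N` is
a unit. -/
lemma natCast_dvd_p_pow {N K : ℕ} (hN : N ≠ 0) (hK : N ≤ K) : (N : ℤ_[p]) ∣ (p : ℤ_[p]) ^ K := by
  obtain ⟨e, N', hN', rfl⟩ := Nat.exists_eq_pow_mul_and_not_dvd hN p (Fact.out : p.Prime).ne_one
  have hu : IsUnit (N' : ℤ_[p]) := by
    rw [PadicInt.isUnit_iff]
    refine le_antisymm (PadicInt.norm_le_one _) (not_lt.1 fun h => hN' ?_)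
    have := (PadicInt.norm_int_lt_one_iff_dvd (p := p) (N' : ℤ)).1 (by simpa using h)
    exact_mod_cast this
  have he : e ≤ K := by
    have h1 : e < p ^ e := Nat.lt_pow_self (Fact.out : p.Prime).one_lt
    have h2 : p ^ e ≤ p ^ e * N' := Nat.le_mul_of_pos_right _
      (Nat.pos_of_ne_zero (right_ne_zero_of_mul hN))
    omega
  push_cast
  rw [IsUnit.mul_right_dvd hu]
  exact pow_dvd_pow _ he

/-- Two integral matrices that are congruent modulo a high power of `p` differ by an element of
`Γ₀(pℤ_p)`. -/
lemma exists_gamma0_of_congr {m₁ m₂ s : Matrix (Fin 2) (Fin 2) ℤ_[p]} {K : ℕ}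
    (h₁ : m₁.det ∣ (p : ℤ_[p]) ^ K) (h : m₂ = m₁ + (p : ℤ_[p]) ^ (K + 1) • s)
    {M₁ M₂ : GL (Fin 2) ℚ_[p]}
    (hM₁ : (M₁ : Matrix (Fin 2) (Fin 2) ℚ_[p]) = m₁.map (PadicInt.Coe.ringHom (p := p)))
    (hM₂ : (M₂ : Matrix (Fin 2) (Fin 2) ℚ_[p]) = m₂.map (PadicInt.Coe.ringHom (p := p))) :
    ∃ σ ∈ gamma0 p, M₂ = σ * M₁ := by
  obtain ⟨δ, hδ⟩ := h₁
  -- Since `p^K = det(m₁) δ` and `det(m₁) = adj(m₁) m₁`, one gets `m₂ = (1 + pA) m₁`. The extra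
  -- power in `K + 1` is what puts `1 + pA` in `Γ₀(pℤ_p)`.
  set A : Matrix (Fin 2) (Fin 2) ℤ_[p] := δ • (s * m₁.adjugate) with hA
  have hdet : IsUnit (1 + (p : ℤ_[p]) • A).det := by
    by_contra hnu
    have h2 : (1 + (p : ℤ_[p]) • A).det ∈ IsLocalRing.maximalIdeal ℤ_[p] := hnu
    rw [PadicInt.maximalIdeal_eq_span_p, Ideal.mem_span_singleton] at h2
    have h3 : (1 + (p : ℤ_[p]) • A).det = 1 + p * (A 0 0 + A 1 1 + p * (A 0 0 * A 1 1 -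
        A 0 1 * A 1 0)) := by
      rw [Matrix.det_fin_two]
      simp
      ring
    rw [h3, ← dvd_sub_left (Dvd.intro _ rfl), add_sub_cancel_right] at h2
    exact PadicInt.p_nonunit (isUnit_of_dvd_one h2)
  have hmul : (1 + (p : ℤ_[p]) • A) * m₁ = m₂ := by
    rw [h, add_mul, one_mul, hA, smul_mul_assoc, smul_mul_assoc, mul_assoc, Matrix.adjugate_mul,
      mul_smul_comm, mul_one, smul_smul, smul_smul, pow_succ, hδ]
    congr 2
    ring
  refine ⟨Matrix.GeneralLinearGroup.map (PadicInt.Coe.ringHom (p := p))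
    (Matrix.GeneralLinearGroup.mk'' _ hdet), ⟨_, ?_, rfl⟩, ?_⟩
  · change (p : ℤ_[p]) ∣ (1 + (p : ℤ_[p]) • A) 1 0
    simp
  · refine Units.ext ?_
    rw [Matrix.GeneralLinearGroup.coe_mul, hM₁, hM₂, ← hmul]
    exact Matrix.map_mul

/-- `s₂` stands for a central scalar; after cancelling `M₁`, the quotient `A₁ A₂⁻¹` relates `g₁` to
`g₂ σ`. -/
lemma double_coset_identity {G : Type*} [Group G] {A₁ A₂ g₁ g₂ M₁ M₂ σ s₁ s₂ : G}
    (h₁ : A₁ = s₁ * g₁ * M₁) (h₂ : A₂ = s₂ * g₂ * M₂) (hM : M₂ = σ * M₁)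
    (hs : ∀ x, s₂ * x = x * s₂) : g₁ = s₁⁻¹ * s₂ * (A₁ * A₂⁻¹) * (g₂ * σ) := by
  subst h₁ h₂ hM
  have e : s₁⁻¹ * s₂ * (s₁ * g₁ * M₁ * (s₂ * g₂ * (σ * M₁))⁻¹) * (g₂ * σ) =
      s₁⁻¹ * (s₂ * (s₁ * g₁ * σ⁻¹ * g₂⁻¹)) * s₂⁻¹ * (g₂ * σ) := by group
  rw [e, hs]
  group

end geometry

/-! ### Finiteness of the double cosets. -/

section finiteness

variable {p : ℕ} [Fact p.Prime] {a b : ℚ}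

lemma exists_int_reducedNorm (n : ℕ) (c : Fin 4 → ℤ) :
    ∃ t : ℤ, ((a.den * b.den : ℕ) : ℚ) * reducedNorm (latticeElt n c : ℍ[ℚ,a,b]) = t := by
  refine ⟨n ^ 2 * (a.den * b.den * c 0 ^ 2 - a.num * b.den * c 1 ^ 2 - b.num * a.den * c 2 ^ 2 +
    a.num * b.num * c 3 ^ 2), ?_⟩
  have h1 : (a.den : ℚ) * a = a.num := Rat.den_mul_eq_num a
  have h2 : (b.den : ℚ) * b = b.num := Rat.den_mul_eq_num b
  simp only [reducedNorm, latticeElt]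
  push_cast
  rw [← h1, ← h2]
  ring

lemma reducedNorm_latticeElt_le (ha : a < 0) (hb : b < 0) (n : ℕ) (c : Fin 4 → ℤ) {B : ℤ}
    (hc : ∀ t, c t ^ 2 ≤ B) :
    reducedNorm (latticeElt n c : ℍ[ℚ,a,b]) ≤ n ^ 2 * (1 - a - b + a * b) * B := by
  have hc' : ∀ t, (c t : ℚ) ^ 2 ≤ B := fun t => by exact_mod_cast hc t
  have hab : 0 < a * b := mul_pos_of_neg_of_neg ha hb
  have h1 : -a * (c 1 : ℚ) ^ 2 ≤ -a * B := mul_le_mul_of_nonneg_left (hc' 1) (by linarith)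
  have h2 : -b * (c 2 : ℚ) ^ 2 ≤ -b * B := mul_le_mul_of_nonneg_left (hc' 2) (by linarith)
  have h3 : a * b * (c 3 : ℚ) ^ 2 ≤ a * b * B := mul_le_mul_of_nonneg_left (hc' 3) hab.le
  have h4 : (c 0 : ℚ) ^ 2 - a * (c 1 : ℚ) ^ 2 - b * (c 2 : ℚ) ^ 2 + a * b * (c 3 : ℚ) ^ 2 ≤
      (1 - a - b + a * b) * B := by linarith [hc' 0]
  have h5 := mul_le_mul_of_nonneg_left h4 (sq_nonneg (n : ℚ))
  simp only [reducedNorm, latticeElt]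
  linarith

lemma latticeElt_ne_zero {n : ℕ} (hn : n ≠ 0) {c : Fin 4 → ℤ} (hc : c ≠ 0) :
    (latticeElt n c : ℍ[ℚ,a,b]) ≠ 0 := by
  intro h
  refine hc (funext fun t => ?_)
  have h0 := congrArg QuaternionAlgebra.re h
  have h1 := congrArg QuaternionAlgebra.imI h
  have h2 := congrArg QuaternionAlgebra.imJ h
  have h3 := congrArg QuaternionAlgebra.imK h
  simp [latticeElt, hn] at h0 h1 h2 h3
  fin_cases t <;> simp [h0, h1, h2, h3]

variable (ι : (ℚ_[p] ⊗[ℚ] ℍ[ℚ,a,b]) ≃ₐ[ℚ_[p]] Matrix (Fin 2) (Fin 2) ℚ_[p])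

/-- Every `g ∈ GL₂(ℚ_p)` divides, up to a scalar, a quaternion of `R` whose reduced norm is bounded
in terms of the determinant of `g`. -/
lemma exists_small_quaternion (ha : a < 0) (hb : b < 0) {R : Subring ℍ[ℚ,a,b]}
    (hι : IsIntegralSplitting p R ι) {n : ℕ} (hn : n ≠ 0)
    (hmem : ∀ t, (latticeElt n (Pi.single t 1) : ℍ[ℚ,a,b]) ∈ R) {K : ℕ}
    (hK : ((a.den * b.den : ℕ) : ℚ) * (n ^ 2 * (1 - a - b + a * b)) ≤ K)
    (g : GL (Fin 2) ℚ_[p]) :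
    ∃ (v N : ℕ) (c : Fin 4 → ℤ) (m : Matrix (Fin 2) (Fin 2) ℤ_[p]) (M : GL (Fin 2) ℚ_[p])
      (u : ℚ_[p]ˣ), N ≠ 0 ∧ N ≤ K ∧ reducedNorm (latticeElt n c : ℍ[ℚ,a,b]) ≠ 0 ∧
      ((a.den * b.den : ℕ) : ℚ) * reducedNorm (latticeElt n c : ℍ[ℚ,a,b]) = p ^ v * N ∧
      m.det ∣ (p : ℤ_[p]) ^ K ∧
      (M : Matrix (Fin 2) (Fin 2) ℚ_[p]) = m.map (PadicInt.Coe.ringHom (p := p)) ∧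
      quatToMatrix ι (latticeElt n c) =
        (u : ℚ_[p]) • ((g * M : GL (Fin 2) ℚ_[p]) : Matrix (Fin 2) (Fin 2) ℚ_[p]) := by
  have hp : 0 < p := (Fact.out : p.Prime).pos
  obtain ⟨u, G, hprim, hdet, hG⟩ := exists_primitive g
  have hspec := PadicInt.unitCoeff_spec hdet
  set v := G.det.valuation with hv
  set w := PadicInt.unitCoeff hdet with hw
  have hdvd : G.det ∣ (p : ℤ_[p]) ^ v := by
    rw [hspec]
    exact (w.isUnit.mul_left_dvd).2 dvd_rfl
  let E : Fin 4 → Matrix (Fin 2) (Fin 2) ℤ_[p] := fun t i j =>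
    ⟨quatToMatrix ι (latticeElt n (Pi.single t 1)) i j, norm_quatToMatrix_le ι hι (hmem t) i j⟩
  obtain ⟨c, hc0, hcB, m, hm⟩ := exists_small_combination E G hprim v hdvd hdet
  set x : ℍ[ℚ,a,b] := latticeElt n c with hx
  have hfx : quatToMatrix ι x = (G * m).map (PadicInt.Coe.ringHom (p := p)) := by
    rw [hx, latticeElt_eq_sum, map_sum, ← hm]
    ext i j
    rw [Matrix.sum_apply, Matrix.map_apply, Matrix.sum_apply, map_sum]
    refine Finset.sum_congr rfl fun t _ => ?_
    rw [map_zsmul, Matrix.smul_apply, Matrix.smul_apply, smul_eq_mul, map_mul, map_intCast,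
      zsmul_eq_mul]
    rfl
  have hdetx : (reducedNorm x : ℚ_[p]) = ((G.det * m.det : ℤ_[p]) : ℚ_[p]) := by
    rw [← det_quatToMatrix ι ha.ne hb.ne, hfx, ← Matrix.det_mul, ← RingHom.mapMatrix_apply,
      ← RingHom.map_det]
    rfl
  have hxpos : 0 < reducedNorm x := reducedNorm_pos ha hb (latticeElt_ne_zero hn hc0)
  have hmdet : m.det ≠ 0 := fun h => by
    rw [h, mul_zero, PadicInt.coe_zero] at hdetx
    exact hxpos.ne' (by exact_mod_cast hdetx)
  set D : ℕ := a.den * b.den with hD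
  have hD0 : (0 : ℚ) < D := by exact_mod_cast Nat.mul_pos a.den_pos b.den_pos
  obtain ⟨t, ht⟩ := exists_int_reducedNorm (a := a) (b := b) n c
  have htp : (t : ℤ_[p]) = D * (G.det * m.det) := by
    refine Subtype.ext ?_
    have h1 : ((t : ℚ) : ℚ_[p]) = ((D : ℚ) : ℚ_[p]) * (reducedNorm x : ℚ_[p]) := by
      rw [← ht, Rat.cast_mul]
    rw [hdetx] at h1
    push_cast at h1 ⊢
    exact h1
  -- The integer `t = D · nrd(x)` equals `D · det G · det m` in `ℤ_p`, and `det G` is `p^v` up to a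
  -- unit.
  have hpt : (p : ℤ) ^ v ∣ t := by
    rw [← PadicInt.pow_p_dvd_int_iff, htp, hspec]
    exact Dvd.intro_left ((D : ℤ_[p]) * w * m.det) (by ring)
  obtain ⟨N', hN'⟩ := hpt
  have htpos : 0 < t := by
    have : (0 : ℚ) < t := by
      rw [← ht]
      exact mul_pos hD0 hxpos
    exact_mod_cast this
  have hN'pos : 0 < N' := by
    rw [hN'] at htpos
    exact pos_of_mul_pos_right htpos (by positivity)
  obtain ⟨N, rfl⟩ := Int.eq_ofNat_of_zero_le hN'pos.le
  have hN0 : N ≠ 0 := by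
    rintro rfl
    simp at hN'pos
  have hDN : (D : ℚ) * reducedNorm x = p ^ v * N := by
    rw [ht, hN']
    push_cast
    rfl
  -- The coordinates satisfy `c t ^ 2 ≤ p^v`, so `D · nrd(x)` is at most a constant times `p^v`; the
  -- cofactor `N` is bounded independently of `g`.
  have hNK : N ≤ K := by
    have hpv : (0 : ℚ) < (p : ℚ) ^ v := by positivity
    have h2 := mul_le_mul_of_nonneg_left (reducedNorm_latticeElt_le ha hb n c hcB) hD0.le
    rw [hDN] at h2
    push_cast at h2
    have h3 : (N : ℚ) ≤ K := by
      refine le_trans (le_of_mul_le_mul_left (h2.trans_eq ?_) hpv) hK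
      ring
    exact_mod_cast h3
  have hmN : m.det ∣ (N : ℤ_[p]) := by
    have hp0 : (p : ℤ_[p]) ^ v ≠ 0 := pow_ne_zero _ (by exact_mod_cast hp.ne')
    refine Dvd.intro_left ((D : ℤ_[p]) * w) (mul_left_cancel₀ hp0 ?_)
    rw [hN', hspec] at htp
    push_cast at htp
    rw [htp]
    ring
  have hMdet : (m.map (PadicInt.Coe.ringHom (p := p))).det ≠ 0 := by
    rw [← RingHom.mapMatrix_apply, ← RingHom.map_det]
    exact fun h => hmdet (Subtype.ext h)
  refine ⟨v, N, c, m, Matrix.GeneralLinearGroup.mkOfDetNeZero _ hMdet, u, hN0, hNK, hxpos.ne', hDN,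
    hmN.trans (natCast_dvd_p_pow hN0 hNK), rfl, ?_⟩
  rw [hfx, Matrix.map_mul, hG, Matrix.GeneralLinearGroup.coe_mul, smul_mul_assoc]
  rfl

lemma reducedNorm_latticeElt_smul (n : ℕ) (q : ℤ) (c : Fin 4 → ℤ) :
    reducedNorm (latticeElt n (q • c) : ℍ[ℚ,a,b]) = q ^ 2 * reducedNorm (latticeElt n c :
      ℍ[ℚ,a,b]) := by
  simp [reducedNorm, latticeElt]
  ring

lemma quatToMatrix_latticeElt_smul (n : ℕ) (q : ℤ) (c : Fin 4 → ℤ) :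
    quatToMatrix ι (latticeElt n (q • c)) = (q : ℚ_[p]) • quatToMatrix ι (latticeElt n c) := by
  have h : (latticeElt n (q • c) : ℍ[ℚ,a,b]) = algebraMap ℚ ℍ[ℚ,a,b] q * latticeElt n c := by
    ext <;> simp [latticeElt] <;> ring
  rw [h, map_mul, quatToMatrix_algebraMap, smul_mul_assoc, one_mul]
  simp

/-- The two quaternions are scaled by `p^w₂` and `p^w₁`, which `hv` chooses so as to equalize their
norms. Congruence modulo `N` then makes their quotient an element of `Γ`, while the congruence of
`m₁` and `m₂` provides `σ`. -/
lemma same_double_coset {R : Subring ℍ[ℚ,a,b]} {n : ℕ}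
    (hmem : ∀ t, (latticeElt n (Pi.single t 1) : ℍ[ℚ,a,b]) ∈ R) {D N K v₁ v₂ w₁ w₂ : ℕ}
    (hv : v₁ + 2 * w₂ = v₂ + 2 * w₁) (hN : N ≠ 0) {c₁ c₂ : Fin 4 → ℤ}
    (hc : ∀ t, (N : ℤ) ∣ p ^ w₂ * c₁ t - p ^ w₁ * c₂ t)
    {m₁ m₂ s : Matrix (Fin 2) (Fin 2) ℤ_[p]} {M₁ M₂ g₁ g₂ : GL (Fin 2) ℚ_[p]} {u₁ u₂ : ℚ_[p]ˣ}
    (hr₁ : reducedNorm (latticeElt n c₁ : ℍ[ℚ,a,b]) ≠ 0)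
    (hr₂ : reducedNorm (latticeElt n c₂ : ℍ[ℚ,a,b]) ≠ 0) (hD : (D : ℚ) ≠ 0)
    (hD₁ : (D : ℚ) * reducedNorm (latticeElt n c₁ : ℍ[ℚ,a,b]) = p ^ v₁ * N)
    (hD₂ : (D : ℚ) * reducedNorm (latticeElt n c₂ : ℍ[ℚ,a,b]) = p ^ v₂ * N)
    (hm : m₁.det ∣ (p : ℤ_[p]) ^ K) (hms : m₂ = m₁ + (p : ℤ_[p]) ^ (K + 1) • s)
    (hM₁ : (M₁ : Matrix (Fin 2) (Fin 2) ℚ_[p]) = m₁.map (PadicInt.Coe.ringHom (p := p)))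
    (hM₂ : (M₂ : Matrix (Fin 2) (Fin 2) ℚ_[p]) = m₂.map (PadicInt.Coe.ringHom (p := p)))
    (h₁ : quatToMatrix ι (latticeElt n c₁) =
      (u₁ : ℚ_[p]) • ((g₁ * M₁ : GL (Fin 2) ℚ_[p]) : Matrix (Fin 2) (Fin 2) ℚ_[p]))
    (h₂ : quatToMatrix ι (latticeElt n c₂) =
      (u₂ : ℚ_[p]) • ((g₂ * M₂ : GL (Fin 2) ℚ_[p]) : Matrix (Fin 2) (Fin 2) ℚ_[p])) :
    ∃ (u : ℚ_[p]ˣ), ∃ γ ∈ gammaGroup p R ι, ∃ σ ∈ gamma0 p,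
      g₁ = Matrix.GeneralLinearGroup.scalar (Fin 2) u * γ * (g₂ * σ) := by
  have hp : p ≠ 0 := (Fact.out : p.Prime).ne_zero
  have hpq : (p : ℚ) ≠ 0 := by exact_mod_cast hp
  have hpp : (p : ℚ_[p]) ≠ 0 := by exact_mod_cast hp
  obtain ⟨σ, hσ, hσM⟩ := exists_gamma0_of_congr hm hms hM₁ hM₂
  choose d hd using hc
  set X₁ : ℍ[ℚ,a,b] := latticeElt n ((p : ℤ) ^ w₂ • c₁) with hX₁
  set X₂ : ℍ[ℚ,a,b] := latticeElt n ((p : ℤ) ^ w₁ • c₂) with hX₂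
  have e₁ : reducedNorm X₁ = ((p : ℚ) ^ w₂) ^ 2 * reducedNorm (latticeElt n c₁ : ℍ[ℚ,a,b]) := by
    rw [hX₁, reducedNorm_latticeElt_smul]
    push_cast
    rfl
  have e₂ : reducedNorm X₂ = ((p : ℚ) ^ w₁) ^ 2 * reducedNorm (latticeElt n c₂ : ℍ[ℚ,a,b]) := by
    rw [hX₂, reducedNorm_latticeElt_smul]
    push_cast
    rfl
  have hn₁ : reducedNorm X₁ ≠ 0 := by
    rw [e₁]
    positivity
  have hn₂ : reducedNorm X₂ ≠ 0 := by
    rw [e₂]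
    positivity
  have hDX₁ : (D : ℚ) * reducedNorm X₁ = p ^ (v₁ + 2 * w₂) * N := by
    rw [e₁, pow_add, pow_mul']
    linear_combination ((p : ℚ) ^ w₂) ^ 2 * hD₁
  have hDX₂ : (D : ℚ) * reducedNorm X₂ = p ^ (v₂ + 2 * w₁) * N := by
    rw [e₂, pow_add, pow_mul']
    linear_combination ((p : ℚ) ^ w₁) ^ 2 * hD₂
  have hnorm : reducedNorm X₁ = reducedNorm X₂ :=
    mul_left_cancel₀ hD (by rw [hDX₁, hDX₂, hv])
  have hsub : X₁ - X₂ = (N : ℍ[ℚ,a,b]) * latticeElt n d := by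
    have hd' : ∀ t, (p : ℚ) ^ w₂ * c₁ t - (p : ℚ) ^ w₁ * c₂ t = N * d t := fun t => by
      exact_mod_cast hd t
    ext <;> simp [hX₁, hX₂, latticeElt]
    · linear_combination (n : ℚ) * hd' 0
    · linear_combination (n : ℚ) * hd' 1
    · linear_combination (n : ℚ) * hd' 2
    · linear_combination (n : ℚ) * hd' 3
  have hγ := quatUnit_mul_inv_mem_normOneUnits hp hn₁ hn₂ (star_latticeElt_mem hmem _)
    (star_latticeElt_mem hmem _) hnorm hN hDX₂ (latticeElt_mem hmem d) hsub
  let F : (ℍ[ℚ,a,b])ˣ →* GL (Fin 2) ℚ_[p] := Units.map (quatToMatrix ι).toMonoidHom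
  let s₁ : ℚ_[p]ˣ := Units.mk0 ((p : ℚ_[p]) ^ w₂) (pow_ne_zero _ hpp) * u₁
  let s₂ : ℚ_[p]ˣ := Units.mk0 ((p : ℚ_[p]) ^ w₁) (pow_ne_zero _ hpp) * u₂
  have hscal : ∀ (z : ℚ_[p]ˣ) (x : GL (Fin 2) ℚ_[p]),
      ((Matrix.GeneralLinearGroup.scalar (Fin 2) z * x : GL (Fin 2) ℚ_[p]) :
        Matrix (Fin 2) (Fin 2) ℚ_[p]) = (z : ℚ_[p]) • (x : Matrix (Fin 2) (Fin 2) ℚ_[p]) :=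
    fun z x => by
      rw [Matrix.GeneralLinearGroup.coe_mul, Matrix.smul_eq_diagonal_mul]
      rfl
  have hF₁ : F (quatUnit X₁ hn₁) = Matrix.GeneralLinearGroup.scalar (Fin 2) s₁ * g₁ * M₁ := by
    refine Units.ext ?_
    rw [mul_assoc, hscal]
    change quatToMatrix ι X₁ = _
    rw [hX₁, quatToMatrix_latticeElt_smul, h₁, smul_smul]
    congr 1
    simp [s₁]
  have hF₂ : F (quatUnit X₂ hn₂) = Matrix.GeneralLinearGroup.scalar (Fin 2) s₂ * g₂ * M₂ := by
    refine Units.ext ?_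
    rw [mul_assoc, hscal]
    change quatToMatrix ι X₂ = _
    rw [hX₂, quatToMatrix_latticeElt_smul, h₂, smul_smul]
    congr 1
    simp [s₂]
  refine ⟨s₁⁻¹ * s₂, F (quatUnit X₁ hn₁ * (quatUnit X₂ hn₂)⁻¹), ⟨_, hγ, rfl⟩, σ, hσ, ?_⟩
  rw [F.map_mul, F.map_inv, (Matrix.GeneralLinearGroup.scalar (Fin 2)).map_mul s₁⁻¹ s₂, map_inv]
  refine double_coset_identity hF₁ hF₂ hσM fun x => Units.ext ?_
  rw [hscal, Matrix.GeneralLinearGroup.coe_mul, Matrix.smul_eq_mul_diagonal]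
  rfl

theorem finiteDoubleCosets_gammaGroup (ha : a < 0) (hb : b < 0) {R : Subring ℍ[ℚ,a,b]} {N₀ : ℕ}
    (hR : IsEichlerOrder R N₀) (hι : IsIntegralSplitting p R ι) :
    FiniteDoubleCosets p (gammaGroup p R ι) := by
  obtain ⟨n, hn, hmem⟩ := exists_latticeElt_mem hR
  set D : ℕ := a.den * b.den with hD
  have hD0 : (D : ℚ) ≠ 0 := by
    exact_mod_cast (Nat.mul_pos a.den_pos b.den_pos).ne'
  obtain ⟨K, hK⟩ := exists_nat_ge ((D : ℚ) * (n ^ 2 * (1 - a - b + a * b)))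
  choose v N c m M u hN0 hNK hr hDN hm hM hx using
    exists_small_quaternion ι ha hb hι hn hmem hK
  have : NeZero K.factorial := ⟨K.factorial_ne_zero⟩
  have : NeZero (p ^ (K + 1)) := ⟨pow_ne_zero _ (Fact.out : p.Prime).ne_zero⟩
  -- An invariant with finitely many values. The modulus `K!` serves all `N ≤ K` at once, and the
  -- parity of `v` ensures `v₁ + 2 (v₂ / 2) = v₂ + 2 (v₁ / 2)`.
  let d : GL (Fin 2) ℚ_[p] → Fin (K + 1) × (Fin 4 → ZMod K.factorial) × ZMod K.factorial × ZMod 2 ×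
      (Fin 2 → Fin 2 → ZMod (p ^ (K + 1))) := fun g =>
    (⟨N g, Nat.lt_succ_of_le (hNK g)⟩, fun t => (c g t : ZMod K.factorial),
      ((p ^ (v g / 2) : ℕ) : ZMod K.factorial), (v g : ZMod 2),
      fun i j => PadicInt.toZModPow (K + 1) (m g i j))
  have hrel : ∀ g₁ g₂, d g₁ = d g₂ → ∃ (u : ℚ_[p]ˣ), ∃ γ ∈ gammaGroup p R ι, ∃ σ ∈ gamma0 p,
      g₁ = Matrix.GeneralLinearGroup.scalar (Fin 2) u * γ * (g₂ * σ) := fun g₁ g₂ h => by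
    simp only [d, Prod.mk.injEq, Fin.mk.injEq] at h
    obtain ⟨hNN, hcc, hpp, hvv, hmm⟩ := h
    have hv : v g₁ + 2 * (v g₂ / 2) = v g₂ + 2 * (v g₁ / 2) := by
      have := (ZMod.natCast_eq_natCast_iff' _ _ _).1 hvv
      omega
    have hdvd : ((N g₁ : ℕ) : ℤ) ∣ K.factorial := by
      exact_mod_cast Nat.dvd_factorial (Nat.pos_of_ne_zero (hN0 g₁)) (hNK g₁)
    have hcong : ∀ t, ((N g₁ : ℕ) : ℤ) ∣ p ^ (v g₂ / 2) * c g₁ t - p ^ (v g₁ / 2) * c g₂ t :=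
      fun t => by
        refine hdvd.trans ?_
        rw [← ZMod.intCast_zmod_eq_zero_iff_dvd]
        have h1 := congrFun hcc t
        push_cast at hpp ⊢
        rw [h1, hpp, sub_self]
    have hs : ∃ s : Matrix (Fin 2) (Fin 2) ℤ_[p], m g₂ = m g₁ + (p : ℤ_[p]) ^ (K + 1) • s := by
      have h2 : ∀ i j, (p : ℤ_[p]) ^ (K + 1) ∣ m g₂ i j - m g₁ i j := fun i j => by
        rw [← Ideal.mem_span_singleton, ← PadicInt.ker_toZModPow, RingHom.mem_ker, map_sub,
          sub_eq_zero]
        exact (congrFun (congrFun hmm i) j).symm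
      choose s hs using h2
      refine ⟨Matrix.of s, ?_⟩
      ext i j
      rw [Matrix.add_apply, Matrix.smul_apply, smul_eq_mul, Matrix.of_apply, ← hs]
      ring
    obtain ⟨s, hs⟩ := hs
    have hDN₂ := hDN g₂
    rw [← hNN] at hDN₂
    exact same_double_coset ι hmem hv (hN0 g₁) hcong (hr g₁) (hr g₂) hD0 (hDN g₁) hDN₂ (hm g₁) hs
      (hM g₁) (hM g₂) (hx g₁) (hx g₂)
  -- One representative is chosen for each value taken by `d`.
  refine ⟨Set.range fun y : Set.range d => y.2.choose, Set.finite_range _, fun g => ?_⟩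
  obtain ⟨u, γ, hγ, σ, hσ, h⟩ := hrel g _ (⟨d g, g, rfl⟩ : Set.range d).2.choose_spec.symm
  exact ⟨u, γ, hγ, _, ⟨⟨d g, g, rfl⟩, rfl⟩, σ, hσ, h⟩

end finiteness

end PadicAut

end

theorem theorem3 (p : ℕ) [Fact p.Prime] (a b : ℚ) (ha : a < 0) (hb : b < 0)
    (Nminus Nplus : ℕ) (hdisc : IsDiscriminant a b Nminus) (hpN : Nat.Coprime p Nminus)
    (hpos : 0 < Nplus) (hcop : Nat.Coprime Nplus (p * Nminus))
    (R : Subring ℍ[ℚ,a,b]) (hR : IsEichlerOrder R Nplus)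
    (ι : (ℚ_[p] ⊗[ℚ] ℍ[ℚ,a,b]) ≃ₐ[ℚ_[p]] Matrix (Fin 2) (Fin 2) ℚ_[p])
    (hι : IsIntegralSplitting p R ι) (k : ℕ) (hk : Even k) :
    ∃ e : rigidEigen p k (gammaGroup p R ι) ≃ₗ[ℚ_[p]] padicEigen p k (gammaGroup p R ι),
      ∀ Φ : rigidEigen p k (gammaGroup p R ι),
        (e Φ : GL (Fin 2) ℚ_[p] → Vk p k) =
          specialization p k (Φ : GL (Fin 2) ℚ_[p] → Dk p) := by
  exact control_of_finite hk (finiteDoubleCosets_gammaGroup ι ha hb hR hι)
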